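/- **Setting.** Consider $f^\star=\min\{f(x): Ax=b,\ x\in\mathcal X\}$, where $\mathcal X\subseteq\mathbb R^n$ is nonempty, closed and convex, $f:\mathbb R^n\to\mathbb R\cup\{+\infty\}$ is proper, closed (lower semicontinuous) and convex, $A\in\mathbb R^{m\times n}$, $b\in\mathbb R^m$, and $\|\cdot\|$ is the Euclidean norm (for $A$: the spectral norm). Assume that an optimal solution exists and that there is a point $x\in\mathrm{relint}(\mathrm{dom} f)$ with $Ax=b$ such that either $x\in\mathrm{relint}(\mathcal X)$, or $x\in\mathcal X$ and $\mathcal X$ is polyhedral. Let $g(y)=\inf_{x\in\mathcal X}\{f(x)+y^T(Ax-b)\}$, let $\mathcal Y^\star$ be the set of maximizers of $g$ over $\mathbb R^m$, and $D_{\mathcal Y^\star}=\min\{\|y\|:y\in\mathcal Y^\star\}$. A point $x\in\mathcal X$ is an $\varepsilon$-solution if $|f(x)-f^\star|\le\varepsilon$ and $\|Ax-b\|\le\varepsilon$. **Smoothers.** A smoother consists of $x_c\in\mathcal X$, a function $d$, a constant $\bar L$ and a squared seminorm $q$. * *Augmented Lagrangian (AL):* $Ax_c=b$, $d(x)=\frac12\|Ax-Ax_c\|^2=\frac12\|Ax-b\|^2$,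 $\bar L=1$, $q(z)=\|Az\|^2$. * *Bregman:* $\mathfrak b$ is a nonnegative continuous $\sigma$-strongly convex function ($\sigma>0$) on $\mathcal X$, differentiable at every point of $\mathcal X$, $d_{\mathfrak b}(x,z)=\mathfrak b(x)-\mathfrak b(z)-\nabla\mathfrak b(z)^T(x-z)$, $d(x)=d_{\mathfrak b}(x,x_c)$, $\bar L=\|A\|^2/\sigma$, $q(z)=\sigma\|z\|^2$ (so $q(z)=\|z\|^2$ for the usual normalization $\sigma=1$). In this case assume $A\ne0$ and $D_{\mathcal X}=\sup_{x,z\in\mathcal X}d_{\mathfrak b}(x,z)<\infty$. Let $x^\star_\gamma(y)$ denote any element of $\arg\min_{x\in\mathcal X}\{f(x)+y^T(Ax-b)+\gamma d(x)\}$, and $\mathrm{prox}(\hat x,\hat y;\beta)$ any element of $\arg\min_{x\in\mathcal X}\{f(x)+\hat y^TA(x-\hat x)+\frac{\bar L}{2\beta}q(x-\hat x)\}$. **Algorithm 1.** Given $\gamma_0>0$ and $c_k\in(-1,1]$, put $\beta_0=\bar L/\gamma_0$, $a_0=\frac12\big(1+c_0+\sqrt{4(1-c_0)+(1+c_0)^2}\big)$,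 $a_{k+1}=\frac12\big(1+c_{k+1}+\sqrt{4a_k^2+(1-c_{k+1})^2}\big)$, $\tau_k=1/a_k$, $\beta_{k+1}=(1-\tau_k)\beta_k$, $\gamma_{k+1}=(1-c_k\tau_k)\gamma_k$. Start either with $\bar x^0=x^\star_{\gamma_0}(0)$, $\bar y^0=\beta_0^{-1}(A\bar x^0-b)$, or with $\bar y^0=\beta_0^{-1}(Ax_c-b)$, $\bar x^0=\mathrm{prox}(x_c,\bar y^0;\beta_0)$. Iterate one of the following two schemes: * (2P1D): $\hat x^k=(1-\tau_k)\bar x^k+\tau_kx^\star_{\gamma_k}(\bar y^k)$, $\hat y^k=\beta_{k+1}^{-1}(A\hat x^k-b)$, $\bar x^{k+1}=\mathrm{prox}(\hat x^k,\hat y^k;\beta_{k+1})$, $\bar y^{k+1}=(1-\tau_k)\bar y^k+\tau_k\hat y^k$; * (1P2D): $\hat y^k=(1-\tau_k)\bar y^k+\tau_k\beta_k^{-1}(A\bar x^k-b)$, $\hat x^\star_k=x^\star_{\gamma_{k+1}}(\hat y^k)$, $\bar x^{k+1}=(1-\tau_k)\bar x^k+\tau_k\hat x^\star_k$, $\bar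 y^{k+1}=\hat y^k+\frac{\gamma_{k+1}}{\bar L}(A\hat x^\star_k-b)$. **Theorem 4.1.** The set $\mathcal Y^\star$ is nonempty and $D_{\mathcal Y^\star}$ is attained. Let $(\bar x^k,\bar y^k)$ be generated by Algorithm 1 in $k\ge0$ iterations. (a) With the AL smoother, $\gamma_0=1$ and $c_k=0$ for all $k$, for either scheme, $$\|A\bar x^k-b\|\le\frac{8D_{\mathcal Y^\star}}{(k+1)^2},\qquad -\tfrac12\|A\bar x^k-b\|^2-D_{\mathcal Y^\star}\|A\bar x^k-b\|\le f(\bar x^k)-f^\star\le0 .$$ There is a function $C$ such that, for every problem and every $\varepsilon>0$, $\bar x^k$ is an $\varepsilon$-solution as soon as $k+1\ge C(D_{\mathcal Y^\star})\,\varepsilon^{-1/2}$; thus the complexity is $O(\varepsilon^{-1/2})$, and the bounds do not involve $\|A\|$. (b) With the Bregman smoother, the scheme (2P1D), $\gamma_0=\sqrt{\bar L}$ and $c_k=1$ for all $k$, $$\|A\bar x^k-b\|\le\frac{\sqrt{\bar L}\,(2D_{\mathcal Y^\star}+\sqrt{2D_{\mathcal X}})}{k+1},\qquad -D_{\mathcal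 Y^\star}\|A\bar x^k-b\|\le f(\bar x^k)-f^\star\le\frac{\sqrt{\bar L}}{k+1}D_{\mathcal X}.$$ (c) With the Bregman smoother, the scheme (1P2D), a fixed horizon $K\ge 0$, $\gamma_0=\frac{2\sqrt{2\bar L}}{K+1}$ and $c_k=0$ for all $k$, $$\|A\bar x^K-b\|\le\frac{2\sqrt{2\bar L}\,(D_{\mathcal Y^\star}+\sqrt{D_{\mathcal X}})}{K+1},\qquad -D_{\mathcal Y^\star}\|A\bar x^K-b\|\le f(\bar x^K)-f^\star\le\frac{2\sqrt{2\bar L}}{K+1}D_{\mathcal X}.$$ In (b) and in (c) there is a function $C$ such that, for every problem and every $\varepsilon>0$, $\bar x^k$ (respectively $\bar x^K$) is an $\varepsilon$-solution as soon as $k+1$ (respectively $K+1$) is at least $C(\bar L,D_{\mathcal Y^\star},D_{\mathcal X})\,\varepsilon^{-1}$; thus the complexity is $O(\varepsilon^{-1})$. -/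

import Mathlib

namespace PrimalDual

noncomputable section

/-- Euclidean space `ℝⁿ`. -/
abbrev Euc (n : ℕ) : Type := EuclideanSpace ℝ (Fin n)

/-- The data of the problem `min { f x : A x = b, x ∈ X }`. The matrix `A` is given by its linear map
between Euclidean spaces, so that `‖P.A‖` is its spectral norm. The values of `f` lie in `EReal`;
that `-∞` is not a value is part of `IsAdmissible`. -/
structure Problem (n m : ℕ) where
  f : Euc n → EReal
  X : Set (Euc n)
  A : Euc n →L[ℝ] Euc m
  b : Euc m

/-- A finite intersection of closed half-spaces. -/
def IsPolyhedral {n : ℕ} (X : Set (Euc n)) : Prop :=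
  ∃ (p : ℕ) (v : Fin p → Euc n) (t : Fin p → ℝ), X = {x | ∀ i, inner ℝ (v i) x ≤ t i}

namespace Problem

variable {n m : ℕ} (P : Problem n m)

/-- The effective domain of `f`. -/
def dom : Set (Euc n) := {x | P.f x < ⊤}

def feasible : Set (Euc n) := {x | x ∈ P.X ∧ P.A x = P.b}

/-- The optimal value `f⋆`. -/
def optVal : EReal := ⨅ x ∈ P.feasible, P.f x

/-- The primal solution set `X⋆`. -/
def solutions : Set (Euc n) := {x | x ∈ P.feasible ∧ ∀ z ∈ P.feasible, P.f x ≤ P.f z}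

/-- The dual function `g y = inf { f x + ⟪y, A x - b⟫ : x ∈ X }`. -/
def dualFun (y : Euc m) : EReal :=
  ⨅ x ∈ P.X, P.f x + ((inner ℝ y (P.A x - P.b) : ℝ) : EReal)

/-- The dual solution set `Y⋆`. -/
def dualSolutions : Set (Euc m) := {y | ∀ z, P.dualFun z ≤ P.dualFun y}

/-- The norm of a minimum norm dual solution. -/
def dualRadius : ℝ := sInf ((fun y => ‖y‖) '' P.dualSolutions)

/-- Standing assumption: `X` is nonempty, closed and convex, `f` is proper, closed and convex, a primal
solution exists, and there is a feasible point in the relative interior of `dom f` which, unless `X` is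
polyhedral, lies in the relative interior of `X` as well. -/
structure IsAdmissible : Prop where
  nonempty : P.X.Nonempty
  closed : IsClosed P.X
  convex : Convex ℝ P.X
  ne_bot : ∀ x, P.f x ≠ ⊥
  proper : P.dom.Nonempty
  lsc : LowerSemicontinuous P.f
  convex_epigraph : Convex ℝ {p : Euc n × ℝ | P.f p.1 ≤ (p.2 : EReal)}
  solvable : P.solutions.Nonempty
  slater : ∃ x, P.A x = P.b ∧ x ∈ intrinsicInterior ℝ P.dom ∧
    ((IsPolyhedral P.X ∧ x ∈ P.X) ∨ x ∈ intrinsicInterior ℝ P.X)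

/-- `x` is an `ε`-solution: `x ∈ X`, `|f x - f⋆| ≤ ε` and `‖A x - b‖ ≤ ε`. -/
def IsEpsSolution (ε : ℝ) (x : Euc n) : Prop :=
  x ∈ P.X ∧ ((-ε : ℝ) : EReal) ≤ P.f x - P.optVal ∧ P.f x - P.optVal ≤ (ε : EReal) ∧
    ‖P.A x - P.b‖ ≤ ε

/-- `x` minimizes `f + φ` over `X`. -/
def IsArgmin (φ : Euc n → ℝ) (x : Euc n) : Prop :=
  x ∈ P.X ∧ ∀ z ∈ P.X, P.f x + (φ x : EReal) ≤ P.f z + (φ z : EReal)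

end Problem

/-- `b` is a smooth prox-function of `X` with strong convexity parameter `σ`. -/
structure IsProxFunction {n : ℕ} (X : Set (Euc n)) (σ : ℝ) (b : Euc n → ℝ) : Prop where
  pos : 0 < σ
  nonneg : ∀ x ∈ X, 0 ≤ b x
  continuousOn : ContinuousOn b X
  strongConvexOn : StrongConvexOn X σ b
  differentiableAt : ∀ x ∈ X, DifferentiableAt ℝ b x

/-- The Bregman distance of `b`. -/
def bregman {n : ℕ} (b : Euc n → ℝ) (x y : Euc n) : ℝ :=
  b x - b y - inner ℝ (gradient b y) (x - y)

def bregmanValues {n : ℕ} (X : Set (Euc n)) (b : Euc n → ℝ) : Set ℝ :=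
  {r | ∃ x ∈ X, ∃ z ∈ X, r = bregman b x z}

/-- The prox-diameter of `X` for the Bregman distance of `b`; used when the set of values is bounded. -/
def proxDiameter {n : ℕ} (X : Set (Euc n)) (b : Euc n → ℝ) : ℝ := sSup (bregmanValues X b)

/-- What the algorithm uses of a smoother: the prox-center `x_c`, the smoothing term
`d x = d_b (S x, S x_c)`, the constant `L̄`, and the squared seminorm `q` in the quadratic term
`(L̄ / (2 β)) * q (x - x̂)` of the proximal step. -/
structure Smoother (n : ℕ) where
  center : Euc n
  d : Euc n → ℝ
  L : ℝ
  q : Euc n → ℝ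

/-- The augmented Lagrangian smoother: `S = A`, `L̄ = 1`; it is used with `A x_c = b`. -/
def alSmoother {n m : ℕ} (P : Problem n m) (xc : Euc n) : Smoother n where
  center := xc
  d x := (1 / 2) * ‖P.A x - P.A xc‖ ^ 2
  L := 1
  q z := ‖P.A z‖ ^ 2

/-- The Bregman smoother for a `σ`-strongly convex prox-function `b`: `L̄ = ‖A‖² / σ`. The seminorm of
the proximal step is `‖z‖² = q z` for `σ = 1`; for general `σ` it is scaled by `σ`, so that
`L̄ * q z = ‖A‖² * ‖z‖²` always majorizes `‖A z‖²`. -/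
def bdSmoother {n m : ℕ} (P : Problem n m) (σ : ℝ) (b : Euc n → ℝ) (xc : Euc n) : Smoother n where
  center := xc
  d x := bregman b x xc
  L := ‖P.A‖ ^ 2 / σ
  q z := σ * ‖z‖ ^ 2

/-- The sequence `a_k` for given parameters `c_k`. -/
def aSeq (c : ℕ → ℝ) : ℕ → ℝ
  | 0 => (1 + c 0 + √(4 * (1 - c 0) + (1 + c 0) ^ 2)) / 2
  | k + 1 => (1 + c (k + 1) + √(4 * aSeq c k ^ 2 + (1 - c (k + 1)) ^ 2)) / 2

/-- The step size `τ_k`. -/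
def tauSeq (c : ℕ → ℝ) (k : ℕ) : ℝ := (aSeq c k)⁻¹

/-- The smoothness parameter `γ_k`. -/
def gammaSeq (γ₀ : ℝ) (c : ℕ → ℝ) : ℕ → ℝ
  | 0 => γ₀
  | k + 1 => (1 - c k * tauSeq c k) * gammaSeq γ₀ c k

/-- The smoothness parameter `β_k`. -/
def betaSeq (β₀ : ℝ) (c : ℕ → ℝ) : ℕ → ℝ
  | 0 => β₀
  | k + 1 => (1 - tauSeq c k) * betaSeq β₀ c k

/-- The two iteration schemes: two primal steps and one dual step, or one primal and two dual steps. -/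
inductive Scheme
  | twoPrimal
  | twoDual

/-- The two rules for the starting point: from the smoothed dual function at `0`, or from one proximal
step at the prox-center. -/
inductive StartRule
  | dualZero
  | proxCenter

section Algorithm

variable {n m : ℕ} (P : Problem n m) (s : Smoother n)

/-- `x` is a solution `x⋆_γ(y)` of the smoothed dual subproblem at `y`. -/
def IsSmoothedSol (γ : ℝ) (y : Euc m) (x : Euc n) : Prop :=
  P.IsArgmin (fun z => inner ℝ y (P.A z - P.b) + γ * s.d z) x

/-- `x` is a value of the proximal mapping at `(x̂, ŷ)` with parameter `β`. -/
def IsProx (β : ℝ) (xh : Euc n) (yh : Euc m) (x : Euc n) : Prop :=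
  P.IsArgmin (fun z => inner ℝ yh (P.A (z - xh)) + s.L / (2 * β) * s.q (z - xh)) x

def IsStart (γ₀ β₀ : ℝ) (x : Euc n) (y : Euc m) : StartRule → Prop
  | .dualZero => IsSmoothedSol P s γ₀ 0 x ∧ y = β₀⁻¹ • (P.A x - P.b)
  | .proxCenter => y = β₀⁻¹ • (P.A s.center - P.b) ∧ IsProx P s β₀ s.center y x

/-- One step from `(x, y)` to `(x', y')`, where `τ = τ_k`, `(γ, β) = (γ_k, β_k)` and
`(γ', β') = (γ_{k+1}, β_{k+1})`. -/
def IsStep (τ γ β γ' β' : ℝ) (x : Euc n) (y : Euc m) (x' : Euc n) (y' : Euc m) : Scheme → Prop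
  | .twoPrimal => ∃ (xs xh : Euc n) (yh : Euc m),
      IsSmoothedSol P s γ y xs ∧
      xh = (1 - τ) • x + τ • xs ∧
      yh = β'⁻¹ • (P.A xh - P.b) ∧
      IsProx P s β' xh yh x' ∧
      y' = (1 - τ) • y + τ • yh
  | .twoDual => ∃ (xs : Euc n) (yh : Euc m),
      yh = (1 - τ) • y + τ • (β⁻¹ • (P.A x - P.b)) ∧
      IsSmoothedSol P s γ' yh xs ∧
      x' = (1 - τ) • x + τ • xs ∧
      y' = yh + (γ' / s.L) • (P.A xs - P.b)

/-- `(x_0, y_0), …, (x_N, y_N)` are generated by `N` iterations of the algorithm with the smoother `s`,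
the given scheme and starting rule, `γ_0`, `β_0 = L̄ / γ_0` and the parameters `c_k`. The sequences are
unconstrained beyond index `N`. -/
def IsRun (scheme : Scheme) (start : StartRule) (γ₀ : ℝ) (c : ℕ → ℝ) (N : ℕ)
    (x : ℕ → Euc n) (y : ℕ → Euc m) : Prop :=
  IsStart P s γ₀ (s.L / γ₀) (x 0) (y 0) start ∧
  ∀ k < N, IsStep P s (tauSeq c k)
    (gammaSeq γ₀ c k) (betaSeq (s.L / γ₀) c k)
    (gammaSeq γ₀ c (k + 1)) (betaSeq (s.L / γ₀) c (k + 1))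
    (x k) (y k) (x (k + 1)) (y (k + 1)) scheme

end Algorithm

end

end PrimalDual

/-! All rates come from two inequalities. Strong duality with a minimum norm multiplier gives `f x ≥
f⋆ - D ‖A x - b‖` on `X`. The algorithm supplies the upper bound `f x + ‖A x - b‖² / (2 β) ≤ f⋆ +
Δ`. Together they give a quadratic inequality for `r = ‖A x - b‖`, namely `r² ≤ 2 β D r + 2 β Δ`, so
`r ≤ 2 β D + √(2 β Δ)` (`bounds_of_penalized_le`).

For the Bregman smoother, and for the AL smoother with two dual steps, the upper bound is the
excessive gap condition: the penalized objective at the primal iterate lies below the smoothed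
Lagrangian, at the dual iterate, of every point. At a feasible minimizer this leaves `Δ = γ d(x⋆)`.
The gap holds at the start and survives each step (`HasExcessiveGap.twoPrimal`,
`HasExcessiveGap.twoDual`): the quadratic growth of the smoothed subproblem pays for the quadratic
error of the step, provided `L̄ τ²` is small against `γ β`. The choices of `c_k` make that condition
an equality.

For the AL smoother with two primal steps and `c_k = 0`, the inductive condition fails by a factor
`1 - τ`. There the proximal step minimizes the quadratic penalty function exactly, so the upper
bound holds without induction (`IsRun.penalty_minimal`). In both AL schemes `d` vanishes at feasible
points, hence `Δ = 0`.

Strong duality under the mixed Slater condition is proved algebraically. The Riesz extension theorem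
puts an affine function between `f` and its minimum over the polyhedron of constraints
(`exists_affine_between`), and Farkas' lemma turns that function into multipliers
(`exists_multipliers`). -/

/-! ### Theorems of the alternative and Lagrange multipliers for linear constraints -/

namespace PrimalDual

section Multipliers

/-- **Farkas' lemma** for finitely many linear functionals on a real vector space. -/
theorem farkas_linear {ι W : Type*} [DecidableEq ι] [AddCommGroup W] [Module ℝ W] (s : Finset ι) :
    ∀ (a : ι → W →ₗ[ℝ] ℝ) (c : W →ₗ[ℝ] ℝ),
      (∀ x, (∀ i ∈ s, a i x ≤ 0) → c x ≤ 0) →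
      ∃ w : ι → ℝ, (∀ i, 0 ≤ w i) ∧ ∀ x, c x = ∑ i ∈ s, w i * a i x := by
  induction s using Finset.induction_on with
  | empty =>
    intro a c h
    refine ⟨fun _ => 0, fun _ => le_rfl, fun x => ?_⟩
    have h1 := h x (by simp)
    have h2 := h (-x) (by simp)
    rw [map_neg] at h2
    simp
    linarith
  | insert j s hj ih =>
    intro a c h
    by_cases hs : ∀ x, (∀ i ∈ s, a i x ≤ 0) → c x ≤ 0
    · obtain ⟨w, hw, hc⟩ := ih a c hs
      refine ⟨fun i => if i = j then 0 else w i, fun i => ?_, fun x => ?_⟩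
      · dsimp only
        split_ifs
        · exact le_rfl
        · exact hw i
      · rw [Finset.sum_insert hj, hc x]
        simp only [if_true, zero_mul, zero_add]
        refine Finset.sum_congr rfl fun i hi => ?_
        rw [if_neg (ne_of_mem_of_not_mem hi hj)]
    · push Not at hs
      obtain ⟨z, hz, hcz⟩ := hs
      have hjz : 0 < a j z := by
        by_contra hn
        refine absurd (h z fun i hi => ?_) (not_le.2 hcz)
        rcases Finset.mem_insert.1 hi with rfl | hi
        · exact not_lt.1 hn
        · exact hz i hi
      set r := a j z with hr
      -- Project along `z` onto the kernel of `a j`: the hypothesis at `x - (a j x / r) • z` is the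
      -- hypothesis for the modified functionals, with constraint `j` removed.
      obtain ⟨w, hw, hc⟩ := ih (fun i => a i - (a i z / r) • a j) (c - (c z / r) • a j) (by
        intro x hx
        have := h (x - (a j x / r) • z) (by
          intro i hi
          rcases Finset.mem_insert.1 hi with rfl | hi
          · simp only [map_sub, map_smul, smul_eq_mul, ← hr]
            field_simp
            simp
          · have := hx i hi
            simp only [LinearMap.sub_apply, LinearMap.smul_apply, smul_eq_mul] at this
            simp only [map_sub, map_smul, smul_eq_mul]
            calc _ = a i x - a i z / r * a j x := by ring
              _ ≤ 0 := this)
        simp only [map_sub, map_smul, smul_eq_mul] at this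
        simp only [LinearMap.sub_apply, LinearMap.smul_apply, smul_eq_mul]
        calc _ = c x - a j x / r * c z := by ring
          _ ≤ 0 := this)
      refine ⟨fun i => if i = j then (c z - ∑ i ∈ s, w i * a i z) / r else w i,
        fun i => ?_, fun x => ?_⟩
      · dsimp only
        split_ifs
        · refine div_nonneg ?_ hjz.le
          have : ∑ i ∈ s, w i * a i z ≤ 0 :=
            Finset.sum_nonpos fun i hi => mul_nonpos_of_nonneg_of_nonpos (hw i) (hz i hi)
          linarith
        · exact hw i
      · rw [Finset.sum_insert hj]
        simp only [if_true]
        have h1 : ∑ i ∈ s, (if i = j then (c z - ∑ i ∈ s, w i * a i z) / r else w i) * a i x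
            = ∑ i ∈ s, w i * a i x :=
          Finset.sum_congr rfl fun i hi => by rw [if_neg (ne_of_mem_of_not_mem hi hj)]
        have h2 := hc x
        simp only [LinearMap.sub_apply, LinearMap.smul_apply, smul_eq_mul, mul_sub,
          Finset.sum_sub_distrib] at h2
        have h3 : ∑ i ∈ s, w i * (a i z / r * a j x) = (∑ i ∈ s, w i * a i z) / r * a j x := by
          rw [Finset.sum_div, Finset.sum_mul]
          exact Finset.sum_congr rfl fun i _ => by ring
        rw [h1]
        rw [h3] at h2
        rw [sub_div, sub_mul]
        linarith

/-- Farkas' lemma for an affine inequality that holds on a nonempty polyhedron. -/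
theorem farkas_affine {ι W : Type*} [Fintype ι] [AddCommGroup W] [Module ℝ W]
    (a : ι → W →ₗ[ℝ] ℝ) (t : ι → ℝ) (c : W →ₗ[ℝ] ℝ) (r : ℝ) (z : W) (hz : ∀ i, a i z ≤ t i)
    (h : ∀ x, (∀ i, a i x ≤ t i) → c x ≤ r) :
    ∃ w : ι → ℝ, (∀ i, 0 ≤ w i) ∧ ∀ x, c x - r ≤ ∑ i, w i * (a i x - t i) := by
  classical
  -- Homogenize: on `W × ℝ` the constraints become `a i x ≤ t i s` together with `-s ≤ 0`, the
  -- latter indexed by `none`.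
  obtain ⟨w, hw, hc⟩ := farkas_linear (Finset.univ : Finset (Option ι))
    (fun o => o.elim (-LinearMap.snd ℝ W ℝ)
      (fun i => (a i).comp (LinearMap.fst ℝ W ℝ) - t i • LinearMap.snd ℝ W ℝ))
    (c.comp (LinearMap.fst ℝ W ℝ) - r • LinearMap.snd ℝ W ℝ) (by
      rintro ⟨x, s⟩ hx
      have h0 := hx none (Finset.mem_univ _)
      have h1 := fun i => hx (some i) (Finset.mem_univ _)
      simp only [Option.elim_none, LinearMap.neg_apply, LinearMap.snd_apply, Option.elim_some,
        LinearMap.sub_apply, LinearMap.comp_apply, LinearMap.fst_apply, LinearMap.smul_apply,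
        smul_eq_mul] at h0 h1 ⊢
      rcases (show 0 ≤ s by linarith).eq_or_lt with rfl | hs
      -- At `s = 0` the vector `x` is a recession direction of the polyhedron, and an affine
      -- function bounded above along the ray from `z` cannot increase.
      · have key : ∀ N : ℕ, c z + N * c x ≤ r := by
          intro N
          have := h (z + (N : ℝ) • x) (fun i => by
            have := h1 i
            simp only [map_add, map_smul, smul_eq_mul]
            have h2 : (N : ℝ) * a i x ≤ 0 :=
              mul_nonpos_of_nonneg_of_nonpos N.cast_nonneg (by linarith)
            linarith [hz i])
          simpa using this
        by_contra hn
        have hpos : 0 < c x := by linarith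
        obtain ⟨N, hN⟩ := exists_nat_gt ((r - c z) / c x)
        rw [div_lt_iff₀ hpos] at hN
        linarith [key N]
      · have := h (s⁻¹ • x) (fun i => by
          have := h1 i
          simp only [map_smul, smul_eq_mul]
          rw [inv_mul_le_iff₀ hs]
          linarith)
        simp only [map_smul, smul_eq_mul] at this
        rw [inv_mul_le_iff₀ hs] at this
        linarith)
  refine ⟨fun i => w (some i), fun i => hw _, fun x => ?_⟩
  have h1 := hc (x, 1)
  rw [Fintype.sum_option] at h1
  simp only [Option.elim_none, LinearMap.neg_apply, LinearMap.snd_apply, Option.elim_some,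
    LinearMap.sub_apply, LinearMap.comp_apply, LinearMap.fst_apply, LinearMap.smul_apply,
    smul_eq_mul, mul_one] at h1
  rw [h1]
  linarith [hw none]

/-- A convex function on a set that absorbs every direction from `0`, minimized over a convex set `M`
through `0`, has an affine minorant that is at least the minimum on `M`. -/
theorem exists_affine_between {V : Type*} [AddCommGroup V] [Module ℝ V] {D M : Set V} {φ : V → ℝ}
    (hφ : ConvexOn ℝ D φ) (hM : Convex ℝ M) (h0 : (0 : V) ∈ M)
    (habs : ∀ v : V, ∃ ε : ℝ, 0 < ε ∧ ε • v ∈ D) {u₀ : V} (hD₀ : u₀ ∈ D) (hM₀ : u₀ ∈ M)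
    (hmin : ∀ u ∈ D, u ∈ M → φ u₀ ≤ φ u) :
    ∃ (l : V →ₗ[ℝ] ℝ) (c : ℝ), (∀ v ∈ D, l v + c ≤ φ v) ∧ ∀ u ∈ M, φ u₀ ≤ l u + c := by
  -- Differences between the epigraph of `φ` and `M × {φ u₀}`; a functional nonnegative on the cone
  -- they span separates the two.
  set C : Set (V × ℝ) := {p | ∃ v ∈ D, ∃ u ∈ M, ∃ s, φ v ≤ s ∧ p = (v - u, s - φ u₀)} with hC
  have hconv : Convex ℝ C := by
    rintro _ ⟨v, hv, u, hu, s, hs, rfl⟩ _ ⟨v', hv', u', hu', s', hs', rfl⟩ α β hα hβ hαβ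
    refine ⟨α • v + β • v', hφ.1 hv hv' hα hβ hαβ, α • u + β • u', hM hu hu' hα hβ hαβ,
      α * s + β * s', ?_, ?_⟩
    · refine (hφ.2 hv hv' hα hβ hαβ).trans ?_
      simp only [smul_eq_mul]
      gcongr
    · refine Prod.ext ?_ ?_
      · simp only [Prod.smul_mk, Prod.mk_add_mk]
        module
      · simp only [Prod.smul_mk, Prod.mk_add_mk, smul_eq_mul]
        linear_combination -φ u₀ * hαβ
  have hK : ∀ p, p ∈ ConvexCone.hull ℝ C ↔ ∃ α : ℝ, 0 < α ∧ ∃ y ∈ C, α • y = p := fun p => by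
    rw [ConvexCone.mem_hull_of_convex hconv]
    simp only [Set.mem_smul_set]
  have hzero : (0 : V × ℝ) ∈ ConvexCone.hull ℝ C := by
    rw [hK]
    exact ⟨1, one_pos, 0, ⟨u₀, hD₀, u₀, hM₀, φ u₀, le_rfl, by simp; rfl⟩, by simp⟩
  -- The functional to extend is the height on the line `{0} × ℝ`, so the separating hyperplane is
  -- not vertical. Positivity on the line is the minimality of `u₀`; absorption moves every vector
  -- into the cone by a vertical shift.
  obtain ⟨g, hg1, hg2⟩ := riesz_extension ((ConvexCone.hull ℝ C).toPointedCone hzero)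
    ⟨LinearMap.range (LinearMap.inr ℝ V ℝ),
      (LinearMap.snd ℝ V ℝ).comp (LinearMap.range (LinearMap.inr ℝ V ℝ)).subtype⟩
    (by
      rintro ⟨_, r, rfl⟩ hx
      change (0 : ℝ) ≤ r
      change ((0 : V), r) ∈ ConvexCone.hull ℝ C at hx
      rw [hK] at hx
      obtain ⟨α, hα, _, ⟨v, hv, u, hu, s, hs, rfl⟩, h⟩ := hx
      simp only [Prod.smul_mk, Prod.mk.injEq, smul_eq_mul] at h
      have hvu : v = u := sub_eq_zero.1 ((smul_eq_zero.1 h.1).resolve_left hα.ne')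
      subst hvu
      rw [← h.2]
      exact mul_nonneg hα.le (by linarith [hmin v hv hu]))
    (by
      rintro ⟨v, r⟩
      obtain ⟨ε, hε, hv⟩ := habs v
      refine ⟨⟨(0, ε⁻¹ * (φ (ε • v) - φ u₀) - r), ⟨_, rfl⟩⟩, ?_⟩
      change ((0 : V), ε⁻¹ * (φ (ε • v) - φ u₀) - r) + (v, r) ∈ ConvexCone.hull ℝ C
      rw [hK]
      refine ⟨ε⁻¹, inv_pos.2 hε, _, ⟨ε • v, hv, 0, h0, _, le_rfl, rfl⟩, ?_⟩
      simp [smul_smul, hε.ne'])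
  have hg : ∀ v r, g (v, r) = g (v, 0) + r := by
    intro v r
    have h1 : g (0, r) = r := hg1 ⟨(0, r), ⟨r, rfl⟩⟩
    have h2 : ((v, r) : V × ℝ) = (v, 0) + (0, r) := by simp
    rw [h2, map_add, h1]
  have key : ∀ v ∈ D, ∀ u ∈ M, φ u₀ + g (u, 0) ≤ φ v + g (v, 0) := by
    intro v hv u hu
    have h1 : ((v - u, φ v - φ u₀) : V × ℝ) ∈ ConvexCone.hull ℝ C := by
      rw [hK]
      exact ⟨1, one_pos, _, ⟨v, hv, u, hu, _, le_rfl, rfl⟩, by simp⟩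
    have h2 := hg2 _ h1
    have h3 : ((v - u, 0) : V × ℝ) = (v, 0) - (u, 0) := by simp
    rw [hg, h3, map_sub] at h2
    linarith
  refine ⟨-(g.comp (LinearMap.inl ℝ V ℝ)), φ u₀ + g (u₀, 0), fun v hv => ?_, fun u hu => ?_⟩
  · have := key v hv u₀ hM₀
    simp only [LinearMap.neg_apply, LinearMap.comp_apply, LinearMap.inl_apply]
    linarith
  · have := key u₀ hD₀ u hu
    simp only [LinearMap.neg_apply, LinearMap.comp_apply, LinearMap.inl_apply]
    linarith

/-- The directions in which a convex set extends on both sides of one of its points. -/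
def twoSidedDirections {E : Type*} [AddCommGroup E] [Module ℝ E] {D : Set E} (hD : Convex ℝ D)
    {x₀ : E} (hx₀ : x₀ ∈ D) : Submodule ℝ E where
  carrier := {v | ∃ ε : ℝ, 0 < ε ∧ x₀ + ε • v ∈ D ∧ x₀ - ε • v ∈ D}
  zero_mem' := ⟨1, one_pos, by simpa using hx₀, by simpa using hx₀⟩
  add_mem' := by
    rintro v w ⟨ε, hε, hv, hv'⟩ ⟨δ, hδ, hw, hw'⟩
    have hs : 0 < ε + δ := by positivity
    have h1 : (δ / (ε + δ)) + ε / (ε + δ) = 1 := by field_simp; ring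
    have ha : 0 ≤ δ / (ε + δ) := by positivity
    have hb : 0 ≤ ε / (ε + δ) := by positivity
    have hc : δ / (ε + δ) * ε = ε * δ / (ε + δ) := by ring
    have hd : ε / (ε + δ) * δ = ε * δ / (ε + δ) := by ring
    -- The weights `δ / (ε + δ)` and `ε / (ε + δ)` give `v` and `w` the same coefficient in the
    -- convex combination.
    refine ⟨ε * δ / (ε + δ), by positivity, ?_, ?_⟩
    · convert hD hv hw ha hb h1 using 1
      rw [smul_add, smul_add (δ / (ε + δ)), smul_add (ε / (ε + δ)), smul_smul, smul_smul, hc, hd,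
        add_add_add_comm, ← add_smul, h1, one_smul]
    · convert hD hv' hw' ha hb h1 using 1
      rw [smul_add, smul_sub (δ / (ε + δ)), smul_sub (ε / (ε + δ)), smul_smul, smul_smul, hc, hd,
        sub_add_sub_comm, ← add_smul, h1, one_smul]
  smul_mem' := by
    rintro c v ⟨ε, hε, hv, hv'⟩
    rcases lt_trichotomy c 0 with hc | rfl | hc
    · have h1 : ε / -c * c = -ε := by rw [div_mul_eq_mul_div, div_eq_iff (by linarith)]; ring
      refine ⟨ε / -c, div_pos hε (by linarith), ?_, ?_⟩
      · rwa [smul_smul, h1, neg_smul, ← sub_eq_add_neg]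
      · rwa [smul_smul, h1, neg_smul, sub_neg_eq_add]
    · exact ⟨1, one_pos, by simpa using hx₀, by simpa using hx₀⟩
    · have h1 : ε / c * c = ε := div_mul_cancel₀ _ hc.ne'
      refine ⟨ε / c, div_pos hε hc, ?_, ?_⟩
      · rwa [smul_smul, h1]
      · rwa [smul_smul, h1]

/-- Lagrange multipliers for a convex function under linear inequalities, under the Slater condition
for linear constraints: a feasible point from which every segment in the domain can be prolonged. -/
theorem exists_multipliers {ι E : Type*} [Fintype ι] [AddCommGroup E] [Module ℝ E] {D : Set E}
    {φ : E → ℝ} (hφ : ConvexOn ℝ D φ) (a : ι → E →ₗ[ℝ] ℝ) (t : ι → ℝ) {x₀ : E} (hx₀ : x₀ ∈ D)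
    (hfeas : ∀ i, a i x₀ ≤ t i) (hext : ∀ x ∈ D, ∃ ε : ℝ, 0 < ε ∧ x₀ - ε • (x - x₀) ∈ D)
    {z : E} (hz : z ∈ D) (hzfeas : ∀ i, a i z ≤ t i)
    (hmin : ∀ x ∈ D, (∀ i, a i x ≤ t i) → φ z ≤ φ x) :
    ∃ w : ι → ℝ, (∀ i, 0 ≤ w i) ∧ ∀ x ∈ D, φ z ≤ φ x + ∑ i, w i * (a i x - t i) := by
  -- After translation by `x₀` the domain absorbs every direction of this subspace, which contains
  -- `x - x₀` for all `x ∈ D`.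
  set V := twoSidedDirections hφ.1 hx₀ with hV
  have hmem : ∀ x ∈ D, x - x₀ ∈ V := by
    intro x hx
    obtain ⟨ε, hε, h⟩ := hext x hx
    refine ⟨min ε 1, lt_min hε one_pos, ?_, ?_⟩
    · have := hφ.1 hx₀ hx (sub_nonneg.2 (min_le_right ε 1)) (lt_min hε one_pos).le (by ring)
      convert this using 1
      module
    · have h0 : 0 ≤ min ε 1 / ε := div_nonneg (lt_min hε one_pos).le hε.le
      have h1 : min ε 1 / ε ≤ 1 := (div_le_one hε).2 (min_le_left _ _)
      have := hφ.1 hx₀ h (sub_nonneg.2 h1) h0 (by ring)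
      convert this using 1
      rw [smul_sub (min ε 1 / ε), smul_smul, div_mul_cancel₀ _ hε.ne']
      module
  obtain ⟨l, c, hl1, hl2⟩ := exists_affine_between (V := V)
    (D := {v : V | x₀ + (v : E) ∈ D}) (M := {v : V | ∀ i, a i (x₀ + (v : E)) ≤ t i})
    (φ := fun v => φ (x₀ + (v : E))) (u₀ := ⟨z - x₀, hmem z hz⟩)
    (by
      refine ⟨?_, ?_⟩
      · intro v hv w hw α β hα hβ hαβ
        have := hφ.1 hv hw hα hβ hαβ
        change x₀ + (α • (v : E) + β • (w : E)) ∈ D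
        convert this using 1
        rw [smul_add, smul_add, add_add_add_comm, ← add_smul, hαβ, one_smul]
      · intro v hv w hw α β hα hβ hαβ
        have := hφ.2 hv hw hα hβ hαβ
        change φ (x₀ + (α • (v : E) + β • (w : E))) ≤ _
        have h1 : α • (x₀ + (v : E)) + β • (x₀ + (w : E)) = x₀ + (α • (v : E) + β • (w : E)) := by
          rw [smul_add, smul_add, add_add_add_comm, ← add_smul, hαβ, one_smul]
        rwa [h1] at this)
    (by
      intro v hv w hw α β hα hβ hαβ i
      have h1 := mul_le_mul_of_nonneg_left (hv i) hα
      have h2 := mul_le_mul_of_nonneg_left (hw i) hβ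
      change a i (x₀ + (α • (v : E) + β • (w : E))) ≤ t i
      simp only [map_add, map_smul, smul_eq_mul] at h1 h2 ⊢
      have h3 : β = 1 - α := by linarith
      subst h3
      linarith)
    (by simpa using hfeas)
    (by
      rintro ⟨v, ε, hε, hv, hv'⟩
      exact ⟨ε, hε, hv⟩)
    (by simpa using hz) (by simpa using hzfeas)
    (by
      intro u hu hu'
      simpa using hmin _ hu hu')
  simp only [add_sub_cancel] at hl2
  -- The affine minorant is at least `φ z` on the translated polyhedron, so `-l ≤ c - φ z` is a
  -- consequence of the linear constraints there.
  obtain ⟨w, hw, h⟩ := farkas_affine (fun i => (a i).comp V.subtype) (fun i => t i - a i x₀)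
    (-l) (c - φ z) 0 (by simpa using hfeas) (by
      intro v hv
      have := hl2 v (fun i => by
        have := hv i
        simp only [LinearMap.comp_apply, Submodule.subtype_apply] at this
        rw [map_add]
        linarith)
      simp only [LinearMap.neg_apply]
      linarith)
  refine ⟨w, hw, fun x hx => ?_⟩
  have h1 := h ⟨x - x₀, hmem x hx⟩
  have h2 := hl1 ⟨x - x₀, hmem x hx⟩ (by simpa using hx)
  simp only [LinearMap.neg_apply, LinearMap.comp_apply, Submodule.subtype_apply, map_sub,
    sub_sub_sub_cancel_right, add_sub_cancel] at h1 h2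
  linarith

end Multipliers

end PrimalDual

/-! ### Strong duality and reduction to real values -/

namespace PrimalDual

section Duality

/-- A segment that ends at a relative interior point can be prolonged inside the set. -/
theorem exists_prolongation {E : Type*} [NormedAddCommGroup E] [NormedSpace ℝ E] {S : Set E}
    {x₀ x : E} (hx₀ : x₀ ∈ intrinsicInterior ℝ S) (hx : x ∈ S) :
    ∃ δ : ℝ, 0 < δ ∧ ∀ ε, 0 ≤ ε → ε < δ → x₀ - ε • (x - x₀) ∈ S := by
  obtain ⟨y, hy, rfl⟩ := mem_intrinsicInterior.1 hx₀
  have hmem : ∀ ε : ℝ, (y : E) - ε • (x - y) ∈ affineSpan ℝ S := by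
    intro ε
    have := AffineMap.lineMap_mem (-ε) y.2 (mem_affineSpan ℝ hx)
    rw [AffineMap.lineMap_apply] at this
    simpa [sub_eq_add_neg, add_comm] using this
  have hcont : Continuous fun ε : ℝ =>
      (⟨(y : E) - ε • (x - y), hmem ε⟩ : affineSpan ℝ S) := by
    refine Continuous.subtype_mk ?_ _
    fun_prop
  have hnhds := (isOpen_interior.preimage hcont).mem_nhds
    (show (0 : ℝ) ∈ _ by simpa using hy)
  obtain ⟨δ, hδ, hball⟩ := Metric.mem_nhds_iff.1 hnhds
  refine ⟨δ, hδ, fun ε h0 h1 => ?_⟩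
  have := hball (show ε ∈ Metric.ball 0 δ by simpa [abs_of_nonneg h0] using h1)
  have hS : (⟨(y : E) - ε • (x - y), hmem ε⟩ : affineSpan ℝ S) ∈ Subtype.val ⁻¹' S :=
    interior_subset this
  exact hS

/-- Multipliers for `A x = b` and finitely many further linear inequalities, for a convex function
on a set whose segments can be prolonged at a feasible point. -/
theorem exists_equality_multiplier {n m p : ℕ} {D : Set (Euc n)}
    {φ : Euc n → ℝ} (hφ : ConvexOn ℝ D φ) (A : Euc n →L[ℝ] Euc m) (b : Euc m) (v : Fin p → Euc n)
    (t : Fin p → ℝ) {x₀ : Euc n} (hx₀ : x₀ ∈ D) (hA : A x₀ = b) (hv : ∀ i, inner ℝ (v i) x₀ ≤ t i)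
    (hext : ∀ x ∈ D, ∃ ε : ℝ, 0 < ε ∧ x₀ - ε • (x - x₀) ∈ D)
    {z : Euc n} (hz : z ∈ D) (hzA : A z = b) (hzv : ∀ i, inner ℝ (v i) z ≤ t i)
    (hmin : ∀ x ∈ D, A x = b → (∀ i, inner ℝ (v i) x ≤ t i) → φ z ≤ φ x) :
    ∃ y : Euc m, ∀ x ∈ D, (∀ i, inner ℝ (v i) x ≤ t i) → φ z ≤ φ x + inner ℝ y (A x - b) := by
  let coord : Fin m → Euc n →ₗ[ℝ] ℝ := fun j =>
    (EuclideanSpace.proj j : Euc m →L[ℝ] ℝ).toLinearMap.comp A.toLinearMap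
  have hcoord : ∀ j x, coord j x = A x j := fun j x => rfl
  obtain ⟨w, hw, h⟩ := exists_multipliers hφ (ι := (Fin m ⊕ Fin m) ⊕ Fin p)
    (Sum.elim (Sum.elim coord fun j => -coord j) fun i => (innerSL ℝ (v i)).toLinearMap)
    (Sum.elim (Sum.elim (fun j => b j) fun j => -b j) t) hx₀
    (by rintro ((j | j) | i) <;> simp [hcoord, hA, hv]) hext hz
    (by rintro ((j | j) | i) <;> simp [hcoord, hzA, hzv])
    (by
      intro x hx hf
      refine hmin x hx ?_ fun i => by simpa using hf (Sum.inr i)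
      ext j
      have h1 := hf (Sum.inl (Sum.inl j))
      have h2 := hf (Sum.inl (Sum.inr j))
      simp only [Sum.elim_inl, Sum.elim_inr, LinearMap.neg_apply, hcoord] at h1 h2
      linarith)
  -- Each equation entered as two opposite inequalities, and their multipliers combine to a
  -- component of free sign. The terms of the other constraints are nonpositive at points that
  -- satisfy them and are dropped.
  refine ⟨WithLp.toLp 2 fun j => w (Sum.inl (Sum.inl j)) - w (Sum.inl (Sum.inr j)),
    fun x hx hxv => ?_⟩
  have h1 := h x hx
  rw [Fintype.sum_sum_type, Fintype.sum_sum_type] at h1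
  have h2 : ∑ i, w (Sum.inr i) * (inner ℝ (v i) x - t i) ≤ 0 :=
    Finset.sum_nonpos fun i _ => mul_nonpos_of_nonneg_of_nonpos (hw _) (by linarith [hxv i])
  simp only [Sum.elim_inl, Sum.elim_inr, LinearMap.neg_apply, hcoord, ContinuousLinearMap.coe_coe,
    innerSL_apply_apply] at h1
  rw [PiLp.inner_apply]
  have h3 : ∑ j, inner ℝ (w (Sum.inl (Sum.inl j)) - w (Sum.inl (Sum.inr j))) ((A x - b) j)
      = ∑ j, w (Sum.inl (Sum.inl j)) * (A x j - b j)
        + ∑ j, w (Sum.inl (Sum.inr j)) * (-A x j - -b j) := by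
    rw [← Finset.sum_add_distrib]
    refine Finset.sum_congr rfl fun j _ => ?_
    simp only [PiLp.sub_apply, RCLike.inner_apply, conj_trivial]
    ring
  rw [h3]
  linarith

namespace Problem

variable {n m : ℕ} (P : Problem n m)

/-- The points of `X` at which the objective is finite. -/
def effDomain : Set (Euc n) := P.X ∩ P.dom

/-- The real value of the objective, meaningful on its effective domain. -/
def value (x : Euc n) : ℝ := (P.f x).toReal

end Problem

namespace Problem.IsAdmissible

variable {n m : ℕ} {P : Problem n m}

theorem coe_value (h : P.IsAdmissible) {x : Euc n} (hx : x ∈ P.dom) :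
    ((P.value x : ℝ) : EReal) = P.f x :=
  EReal.coe_toReal (ne_of_lt hx) (h.ne_bot x)

theorem convexOn_dom (h : P.IsAdmissible) : ConvexOn ℝ P.dom P.value := by
  have key : ∀ ⦃x⦄, x ∈ P.dom → ∀ ⦃y⦄, y ∈ P.dom → ∀ ⦃a b : ℝ⦄, 0 ≤ a → 0 ≤ b → a + b = 1 →
      P.f (a • x + b • y) ≤ ((a * P.value x + b * P.value y : ℝ) : EReal) := by
    intro x hx y hy a b ha hb hab
    have hx' : (x, P.value x) ∈ {p : Euc n × ℝ | P.f p.1 ≤ (p.2 : EReal)} := (h.coe_value hx).ge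
    have hy' : (y, P.value y) ∈ {p : Euc n × ℝ | P.f p.1 ≤ (p.2 : EReal)} := (h.coe_value hy).ge
    exact h.convex_epigraph hx' hy' ha hb hab
  have hdom : Convex ℝ P.dom := fun x hx y hy a b ha hb hab =>
    (key hx hy ha hb hab).trans_lt (EReal.coe_lt_top _)
  refine ⟨hdom, fun x hx y hy a b ha hb hab => ?_⟩
  have := key hx hy ha hb hab
  rw [← h.coe_value (hdom hx hy ha hb hab)] at this
  exact EReal.coe_le_coe_iff.1 this

theorem convexOn_effDomain (h : P.IsAdmissible) : ConvexOn ℝ P.effDomain P.value :=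
  h.convexOn_dom.subset Set.inter_subset_right (h.convex.inter h.convexOn_dom.1)

theorem exists_solution (h : P.IsAdmissible) :
    ∃ z ∈ P.effDomain, P.A z = P.b ∧ P.optVal = (P.value z : EReal) ∧
      ∀ x ∈ P.effDomain, P.A x = P.b → P.value z ≤ P.value x := by
  obtain ⟨z, ⟨hzX, hzA⟩, hz⟩ := h.solvable
  obtain ⟨x₀, hx₀A, hx₀, hx₀X⟩ := h.slater
  have hx₀d : x₀ ∈ P.dom := intrinsicInterior_subset hx₀
  have hx₀f : x₀ ∈ P.feasible :=
    ⟨hx₀X.elim (fun hp => hp.2) (fun hi => intrinsicInterior_subset hi), hx₀A⟩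
  have hzd : z ∈ P.dom := (hz x₀ hx₀f).trans_lt hx₀d
  refine ⟨z, ⟨hzX, hzd⟩, hzA, ?_, fun x hx hxA => ?_⟩
  · rw [h.coe_value hzd]
    exact le_antisymm (iInf₂_le z ⟨hzX, hzA⟩) (le_iInf₂ hz)
  · have := hz x ⟨hx.1, hxA⟩
    rw [← h.coe_value hzd, ← h.coe_value hx.2] at this
    exact EReal.coe_le_coe_iff.1 this

/-- A polyhedral `X` joins the linear constraints, and only `dom f` has to allow prolongation at the
Slater point. Otherwise `X` is absorbed into the domain, where the Slater point is relatively
interior to both sets, and only `A x = b` remains as a constraint. -/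
theorem exists_dual_multiplier (h : P.IsAdmissible) {z : Euc n} (hz : z ∈ P.effDomain)
    (hzA : P.A z = P.b) (hmin : ∀ x ∈ P.effDomain, P.A x = P.b → P.value z ≤ P.value x) :
    ∃ y, ∀ x ∈ P.effDomain, P.value z ≤ P.value x + inner ℝ y (P.A x - P.b) := by
  obtain ⟨x₀, hx₀A, hx₀, ⟨⟨p, v, t, hX⟩, hx₀X⟩ | hx₀X⟩ := h.slater
  · have hmem : ∀ x, x ∈ P.X ↔ ∀ i, inner ℝ (v i) x ≤ t i := fun x => by rw [hX]; rfl
    obtain ⟨y, hy⟩ := exists_equality_multiplier h.convexOn_dom P.A P.b v t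
      (intrinsicInterior_subset hx₀) hx₀A ((hmem _).1 hx₀X)
      (fun x hx => by
        obtain ⟨δ, hδ, hε⟩ := exists_prolongation hx₀ hx
        exact ⟨δ / 2, half_pos hδ, hε _ (half_pos hδ).le (half_lt_self hδ)⟩)
      hz.2 hzA ((hmem _).1 hz.1) (fun x hx hxA hxv => hmin x ⟨(hmem x).2 hxv, hx⟩ hxA)
    exact ⟨y, fun x hx => hy x hx.2 ((hmem x).1 hx.1)⟩
  · obtain ⟨y, hy⟩ := exists_equality_multiplier (p := 0) h.convexOn_effDomain P.A P.b
      (fun _ => 0) (fun _ => 0) (x₀ := x₀)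
      ⟨intrinsicInterior_subset hx₀X, intrinsicInterior_subset hx₀⟩ hx₀A (fun i => i.elim0)
      (fun x hx => by
        obtain ⟨δ, hδ, hε⟩ := exists_prolongation hx₀ hx.2
        obtain ⟨η, hη, hε'⟩ := exists_prolongation hx₀X hx.1
        have hpos : 0 < min δ η := lt_min hδ hη
        have hlt := half_lt_self hpos
        exact ⟨min δ η / 2, half_pos hpos,
          hε' _ (half_pos hpos).le (hlt.trans_le (min_le_right _ _)),
          hε _ (half_pos hpos).le (hlt.trans_le (min_le_left _ _))⟩)
      hz hzA (fun i => i.elim0) (fun x hx hxA _ => hmin x hx hxA)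
    exact ⟨y, fun x hx => hy x hx fun i => i.elim0⟩

theorem coe_le_dualFun_iff (h : P.IsAdmissible) (r : ℝ) (y : Euc m) :
    (r : EReal) ≤ P.dualFun y ↔
      ∀ x ∈ P.effDomain, r ≤ P.value x + inner ℝ y (P.A x - P.b) := by
  unfold Problem.dualFun
  rw [le_iInf₂_iff]
  constructor
  · intro H x hx
    have := H x hx.1
    rw [← h.coe_value hx.2, ← EReal.coe_add] at this
    exact EReal.coe_le_coe_iff.1 this
  · intro H x hx
    by_cases hd : x ∈ P.dom
    · rw [← h.coe_value hd, ← EReal.coe_add]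
      exact EReal.coe_le_coe_iff.2 (H x ⟨hx, hd⟩)
    · have : P.f x = ⊤ := not_lt_top_iff.1 hd
      rw [this, EReal.top_add_coe]
      exact le_top

/-- By weak duality the dual function never exceeds the optimal value, and a multiplier attains that
value; so the dual maximizers are exactly the multipliers. -/
theorem mem_dualSolutions_iff (h : P.IsAdmissible) {z : Euc n} (hz : z ∈ P.effDomain)
    (hzA : P.A z = P.b) (hmin : ∀ x ∈ P.effDomain, P.A x = P.b → P.value z ≤ P.value x)
    (y : Euc m) :
    y ∈ P.dualSolutions ↔
      ∀ x ∈ P.effDomain, P.value z ≤ P.value x + inner ℝ y (P.A x - P.b) := by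
  have weak : ∀ y, P.dualFun y ≤ (P.value z : EReal) := by
    intro y
    refine (iInf₂_le z hz.1).trans ?_
    rw [hzA, sub_self, inner_zero_right, EReal.coe_zero, add_zero, h.coe_value hz.2]
  obtain ⟨y₀, hy₀⟩ := h.exists_dual_multiplier hz hzA hmin
  rw [← h.coe_le_dualFun_iff]
  exact ⟨fun hy => ((h.coe_le_dualFun_iff _ _).2 hy₀).trans (hy y₀), fun hy w => (weak w).trans hy⟩

/-- The multipliers form a nonempty intersection of closed half-spaces in a finite-dimensional
space, so the origin has a nearest point among them. -/
theorem isLeast_dualRadius (h : P.IsAdmissible) :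
    IsLeast ((fun y => ‖y‖) '' P.dualSolutions) P.dualRadius := by
  obtain ⟨z, hz, hzA, -, hmin⟩ := h.exists_solution
  have hiff := h.mem_dualSolutions_iff hz hzA hmin
  have hclosed : IsClosed P.dualSolutions := by
    have : P.dualSolutions = ⋂ x ∈ P.effDomain,
        {y | P.value z ≤ P.value x + inner ℝ y (P.A x - P.b)} := by
      ext y
      simp only [hiff, Set.mem_iInter, Set.mem_ofPred_eq]
    rw [this]
    exact isClosed_biInter fun x _ => isClosed_le continuous_const (by fun_prop)
  have hne : P.dualSolutions.Nonempty := by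
    obtain ⟨y, hy⟩ := h.exists_dual_multiplier hz hzA hmin
    exact ⟨y, (hiff y).2 hy⟩
  obtain ⟨y, hy, hdist⟩ := hclosed.exists_infDist_eq_dist hne 0
  have hleast : IsLeast ((fun y => ‖y‖) '' P.dualSolutions) ‖y‖ := by
    refine ⟨⟨y, hy, rfl⟩, ?_⟩
    rintro _ ⟨w, hw, rfl⟩
    have := Metric.infDist_le_dist_of_mem (x := 0) hw
    rw [hdist] at this
    simpa [dist_zero_left] using this
  have : P.dualRadius = ‖y‖ := hleast.csInf_eq
  rwa [this]

/-- Strong duality: the objective is bounded below by the optimal value up to the minimum norm of a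
dual solution times the feasibility gap. -/
theorem exists_optimal_lower_bound (h : P.IsAdmissible) :
    ∃ z ∈ P.effDomain, P.A z = P.b ∧ P.optVal = (P.value z : EReal) ∧ 0 ≤ P.dualRadius ∧
      ∀ x ∈ P.effDomain, P.value z - P.dualRadius * ‖P.A x - P.b‖ ≤ P.value x := by
  obtain ⟨z, hz, hzA, hopt, hmin⟩ := h.exists_solution
  obtain ⟨y, hy, hnorm⟩ := h.isLeast_dualRadius.1
  dsimp only at hnorm
  refine ⟨z, hz, hzA, hopt, hnorm ▸ norm_nonneg y, fun x hx => ?_⟩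
  have h1 := (h.mem_dualSolutions_iff hz hzA hmin y).1 hy x hx
  have h2 := real_inner_le_norm y (P.A x - P.b)
  rw [hnorm] at h2
  linarith

/-- Some point of `X` has a finite objective value, so a minimizer cannot have the value `⊤`, and
the comparison descends to real numbers. -/
theorem isArgmin_real (h : P.IsAdmissible) {φ : Euc n → ℝ} {x : Euc n} (hx : P.IsArgmin φ x) :
    x ∈ P.effDomain ∧ ∀ z ∈ P.effDomain, P.value x + φ x ≤ P.value z + φ z := by
  obtain ⟨z, hz, -⟩ := h.exists_solution
  have hxd : x ∈ P.dom := by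
    by_contra hd
    have htop : P.f x = ⊤ := not_lt_top_iff.1 hd
    have := hx.2 z hz.1
    rw [htop, EReal.top_add_coe, ← h.coe_value hz.2, ← EReal.coe_add] at this
    exact absurd this (not_le.2 (EReal.coe_lt_top _))
  refine ⟨⟨hx.1, hxd⟩, fun w hw => ?_⟩
  have := hx.2 w hw.1
  rw [← h.coe_value hxd, ← h.coe_value hw.2, ← EReal.coe_add, ← EReal.coe_add] at this
  exact EReal.coe_le_coe_iff.1 this

end Problem.IsAdmissible

end Duality

end PrimalDual

/-! ### The excessive gap condition along the iterations -/

namespace PrimalDual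

section ExcessiveGap

variable {n m : ℕ} {P : Problem n m} {s : Smoother n}

/-- What the convergence analysis needs of a smoother: `L̄ q` majorizes `‖A ·‖²`, and `d` is strongly
convex with respect to `q` and grows at least like `q (· - x_c) / 2` on `X`. -/
structure Smoother.IsCompatible (s : Smoother n) (P : Problem n m) : Prop where
  L_pos : 0 < s.L
  sq_norm_le : ∀ z, ‖P.A z‖ ^ 2 ≤ s.L * s.q z
  q_smul : ∀ (t : ℝ) z, s.q (t • z) = t ^ 2 * s.q z
  half_q_le : ∀ x ∈ P.X, s.q (x - s.center) / 2 ≤ s.d x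
  d_combo_le : ∀ x ∈ P.X, ∀ z ∈ P.X, ∀ t : ℝ, 0 ≤ t → t ≤ 1 →
    s.d ((1 - t) • x + t • z) ≤ (1 - t) * s.d x + t * s.d z - t * (1 - t) / 2 * s.q (z - x)

theorem Smoother.IsCompatible.q_nonneg (hs : s.IsCompatible P) (z : Euc n) : 0 ≤ s.q z :=
  nonneg_of_mul_nonneg_right ((sq_nonneg _).trans (hs.sq_norm_le z)) hs.L_pos

theorem Smoother.IsCompatible.d_nonneg (hs : s.IsCompatible P) {x : Euc n} (hx : x ∈ P.X) :
    0 ≤ s.d x :=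
  (div_nonneg (hs.q_nonneg _) zero_le_two).trans (hs.half_q_le x hx)

/-- Quadratic growth away from a minimizer, along one segment. -/
theorem growth_of_le_combo {v w Q : ℝ} (hQ : 0 ≤ Q)
    (h : ∀ t : ℝ, 0 < t → t < 1 → v ≤ (1 - t) * v + t * w - t * (1 - t) / 2 * Q) :
    v + Q / 2 ≤ w := by
  by_contra hn
  push Not at hn
  have key : ∀ t : ℝ, 0 < t → t < 1 → v + (1 - t) / 2 * Q ≤ w := by
    intro t h0 h1
    have := h t h0 h1
    refine le_of_mul_le_mul_left ?_ h0
    linarith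
  rcases hQ.eq_or_lt with rfl | hQ
  · have := key (1 / 2) (by norm_num) (by norm_num)
    linarith
  · have h2 := key (1 / 2) (by norm_num) (by norm_num)
    have ht : 0 < (v + Q / 2 - w) / Q := div_pos (by linarith) hQ
    have ht1 : (v + Q / 2 - w) / Q < 1 := by rw [div_lt_one hQ]; linarith
    have h3 := key _ ht ht1
    have h4 : (v + Q / 2 - w) / Q * Q = v + Q / 2 - w := div_mul_cancel₀ _ hQ.ne'
    linarith

/-- The excessive gap condition: the penalized objective at `x` is at most the smoothed dual function
at `y`. -/
def HasExcessiveGap (P : Problem n m) (s : Smoother n) (γ β : ℝ) (x : Euc n) (y : Euc m) : Prop :=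
  x ∈ P.effDomain ∧ ∀ z ∈ P.effDomain,
    P.value x + ‖P.A x - P.b‖ ^ 2 / (2 * β) ≤
      P.value z + inner ℝ y (P.A z - P.b) + γ * s.d z

theorem map_combo_sub {x z : Euc n} (t : ℝ) :
    P.A ((1 - t) • x + t • z) - P.b = (1 - t) • (P.A x - P.b) + t • (P.A z - P.b) := by
  rw [map_add, map_smul, map_smul]
  module

/-- The subproblem inherits from `γ d` strong convexity with respect to `γ q`, so its value grows
quadratically away from the minimizer. This growth absorbs the quadratic error of each step. -/
theorem IsSmoothedSol.growth (h : P.IsAdmissible) (hs : s.IsCompatible P) {γ : ℝ} (hγ : 0 ≤ γ)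
    {y : Euc m} {x : Euc n} (hx : IsSmoothedSol P s γ y x) :
    x ∈ P.effDomain ∧ ∀ z ∈ P.effDomain,
      P.value x + inner ℝ y (P.A x - P.b) + γ * s.d x + γ * s.q (z - x) / 2 ≤
        P.value z + inner ℝ y (P.A z - P.b) + γ * s.d z := by
  obtain ⟨hxD, hmin⟩ := h.isArgmin_real hx
  refine ⟨hxD, fun z hz => growth_of_le_combo (mul_nonneg hγ (hs.q_nonneg _)) fun t h0 h1 => ?_⟩
  have hc := h.convexOn_effDomain.1 hxD hz (sub_nonneg.2 h1.le) h0.le (by ring)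
  have h2 := hmin _ hc
  have h3 := h.convexOn_effDomain.2 hxD hz (sub_nonneg.2 h1.le) h0.le (by ring)
  have h4 := mul_le_mul_of_nonneg_left (hs.d_combo_le x hxD.1 z hz.1 t h0.le h1.le) hγ
  have h5 : inner ℝ y (P.A ((1 - t) • x + t • z) - P.b)
      = (1 - t) * inner ℝ y (P.A x - P.b) + t * inner ℝ y (P.A z - P.b) := by
    rw [map_combo_sub, inner_add_right, real_inner_smul_right, real_inner_smul_right]
  simp only [smul_eq_mul] at h3
  rw [h5] at h2
  linarith

theorem IsProx.minimal (h : P.IsAdmissible) {β : ℝ} {xh : Euc n} {yh : Euc m} {x : Euc n}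
    (hx : IsProx P s β xh yh x) :
    x ∈ P.effDomain ∧ ∀ z ∈ P.effDomain,
      P.value x + inner ℝ yh (P.A (x - xh)) + s.L / (2 * β) * s.q (x - xh) ≤
        P.value z + inner ℝ yh (P.A (z - xh)) + s.L / (2 * β) * s.q (z - xh) := by
  obtain ⟨hxD, hmin⟩ := h.isArgmin_real hx
  refine ⟨hxD, fun z hz => ?_⟩
  have := hmin z hz
  linarith

/-- Since `β₀ = L̄ / γ`, the penalty and the smoothing have matching weights. In both starting rules
`L̄ q ≥ ‖A ·‖²` reduces the claim to an inequality between squares, in which one nonnegative square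
is discarded. -/
theorem hasExcessiveGap_of_isStart (h : P.IsAdmissible) (hs : s.IsCompatible P) {γ : ℝ}
    (hγ : 0 < γ) {x : Euc n} {y : Euc m} {start : StartRule}
    (hst : IsStart P s γ (s.L / γ) x y start) : HasExcessiveGap P s γ (s.L / γ) x y := by
  have hL := hs.L_pos
  have hβ : 0 < s.L / γ := div_pos hL hγ
  cases start with
  | dualZero =>
    obtain ⟨hx, rfl⟩ := hst
    obtain ⟨hxD, hgr⟩ := hx.growth h hs hγ.le
    refine ⟨hxD, fun z hz => ?_⟩
    have h1 := hgr z hz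
    have h2 := hs.sq_norm_le (z - x)
    have h3 := mul_nonneg hγ.le (hs.d_nonneg hxD.1)
    simp only [inner_zero_left] at h1
    set u := P.A z - P.b with hu
    set v := P.A x - P.b with hv
    have h4 : P.A (z - x) = u - v := by rw [hu, hv, map_sub]; abel
    rw [h4, norm_sub_sq_real] at h2
    rw [real_inner_smul_left, inv_div]
    have h5 : ‖v‖ ^ 2 / (2 * (s.L / γ)) = γ / s.L * (‖v‖ ^ 2 / 2) := by field_simp
    have h6 : γ * s.q (z - x) / 2 = γ / s.L * (s.L * s.q (z - x) / 2) := by field_simp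
    have h7 := real_inner_comm u v
    have h8 : γ / s.L * (‖v‖ ^ 2 / 2) ≤ γ / s.L * (inner ℝ v u + s.L * s.q (z - x) / 2) := by
      refine mul_le_mul_of_nonneg_left ?_ (div_pos hγ hL).le
      nlinarith [sq_nonneg ‖u‖]
    rw [h5]
    linarith
  | proxCenter =>
    obtain ⟨rfl, hx⟩ := hst
    obtain ⟨hxD, hmin⟩ := IsProx.minimal h hx
    refine ⟨hxD, fun z hz => ?_⟩
    have h1 := hmin z hz
    have h2 := hs.sq_norm_le (x - s.center)
    have h3 := mul_le_mul_of_nonneg_left (hs.half_q_le z hz.1) hγ.le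
    set v := P.A s.center - P.b with hv
    set w := P.A (x - s.center) with hw
    have hx' : P.A x - P.b = v + w := by rw [hv, hw, map_sub]; abel
    have hz' : P.A z - P.b = v + P.A (z - s.center) := by rw [hv, map_sub]; abel
    rw [hx', hz', inner_add_right, norm_add_sq_real]
    have h4 : s.L / (2 * (s.L / γ)) = γ / 2 := by field_simp
    simp only [real_inner_smul_left, inv_div, real_inner_self_eq_norm_sq, h4] at h1 ⊢
    have h5 : ∀ r, r / (2 * (s.L / γ)) = γ / s.L * (r / 2) := fun r => by field_simp
    have h6 : γ / 2 * s.q (x - s.center) = γ / s.L * (s.L * s.q (x - s.center) / 2) := by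
      field_simp
    have h7 : γ / s.L * ((‖v‖ ^ 2 + 2 * inner ℝ v w + ‖w‖ ^ 2) / 2)
        ≤ γ / s.L * (‖v‖ ^ 2 + inner ℝ v w + s.L * s.q (x - s.center) / 2) := by
      refine mul_le_mul_of_nonneg_left ?_ (div_pos hγ hL).le
      nlinarith [sq_nonneg ‖v‖]
    rw [h5]
    linarith

/-- A step with two primal updates preserves the excessive gap. -/
theorem HasExcessiveGap.twoPrimal (h : P.IsAdmissible) (hs : s.IsCompatible P)
    {τ γ β γ' β' : ℝ} (hτ : 0 < τ) (hτ1 : τ < 1) (hγ : 0 < γ) (hβ : 0 < β)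
    (hγ' : (1 - τ) * γ ≤ γ') (hβ' : β' = (1 - τ) * β) (hcond : s.L * τ ^ 2 ≤ (1 - τ) * γ * β')
    {x x' : Euc n} {y y' : Euc m} (hg : HasExcessiveGap P s γ β x y)
    (hstep : IsStep P s τ γ β γ' β' x y x' y' .twoPrimal) :
    HasExcessiveGap P s γ' β' x' y' := by
  obtain ⟨xs, xh, yh, hxs, hxh, hyh, hx', rfl⟩ := hstep
  obtain ⟨hxsD, hgr⟩ := hxs.growth h hs hγ.le
  obtain ⟨hxD', hmin⟩ := IsProx.minimal h hx'
  obtain ⟨hxD, hgap⟩ := hg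
  have hσ : 0 < 1 - τ := by linarith
  have hβ'pos : 0 < β' := hβ' ▸ mul_pos hσ hβ
  refine ⟨hxD', fun z hz => ?_⟩
  -- The proximal point is compared with `(1 - τ) x + τ z` rather than with `z`: its distance from
  -- `xh` is only `τ (z - xs)`, so the quadratic term carries the factor `τ²`.
  have h1 := hmin _ (h.convexOn_effDomain.1 hxD hz hσ.le hτ.le (by ring))
  have h2 := h.convexOn_effDomain.2 hxD hz hσ.le hτ.le (by ring)
  simp only [smul_eq_mul] at h2
  have h3 := hgr z hz
  have h4 := hgap xs hxsD
  have h5 := hs.sq_norm_le (x' - xh)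
  have hdiff : (1 - τ) • x + τ • z - xh = τ • (z - xs) := by rw [hxh]; module
  rw [hdiff, hs.q_smul, map_smul, real_inner_smul_right] at h1
  set v := P.A x - P.b with hv
  set w := P.A xs - P.b with hw
  set u := P.A z - P.b with hu
  set p := P.A (x' - xh) with hp
  have hxh' : P.A xh - P.b = (1 - τ) • v + τ • w := by rw [hxh, map_combo_sub]
  have hx'' : P.A x' - P.b = (P.A xh - P.b) + p := by rw [hp, map_sub]; abel
  have hzs : P.A (z - xs) = u - w := by rw [hu, hw, map_sub]; abel
  set k := P.A xh - P.b with hk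
  rw [hzs, hyh, real_inner_smul_left, real_inner_smul_left, inner_sub_right] at h1
  rw [hx'', hyh, inner_add_left, real_inner_smul_left, real_inner_smul_left, real_inner_smul_left]
  have h6 : ‖k + p‖ ^ 2 / (2 * β') = β'⁻¹ * (‖k‖ ^ 2 / 2 + inner ℝ k p + ‖p‖ ^ 2 / 2) := by
    rw [norm_add_sq_real]
    field_simp
  have h7 : β'⁻¹ * (‖p‖ ^ 2 / 2) ≤ s.L / (2 * β') * s.q (x' - xh) := by
    calc _ ≤ β'⁻¹ * (s.L * s.q (x' - xh) / 2) :=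
          mul_le_mul_of_nonneg_left (by linarith) (inv_pos.2 hβ'pos).le
      _ = _ := by field_simp
  -- This is where `hcond` enters: the proximal error is paid by `1 - τ` times the growth of the
  -- smoothed subproblem at `xs`.
  have h8 : s.L / (2 * β') * (τ ^ 2 * s.q (z - xs)) ≤ (1 - τ) * (γ * s.q (z - xs) / 2) := by
    have : s.L * τ ^ 2 / β' ≤ (1 - τ) * γ := (div_le_iff₀ hβ'pos).2 hcond
    have := mul_le_mul_of_nonneg_right this (div_nonneg (hs.q_nonneg (z - xs)) zero_le_two)
    calc _ = s.L * τ ^ 2 / β' * (s.q (z - xs) / 2) := by field_simp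
      _ ≤ _ := this
      _ = _ := by ring
  have h9 : ‖v‖ ^ 2 / (2 * β) = (1 - τ) * (β'⁻¹ * (‖v‖ ^ 2 / 2)) := by
    rw [hβ']
    field_simp
  -- Because `k - τ w = (1 - τ) v`, expanding the square and dropping `‖τ w‖²` gives the bound.
  have h10 : ‖k‖ ^ 2 / 2 - τ * inner ℝ k w ≤ (1 - τ) ^ 2 * (‖v‖ ^ 2 / 2) := by
    have e1 : ‖k - τ • w‖ ^ 2 = (1 - τ) ^ 2 * ‖v‖ ^ 2 := by
      rw [hxh', add_sub_cancel_right, norm_smul, mul_pow, Real.norm_eq_abs, sq_abs]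
    rw [norm_sub_sq_real, real_inner_smul_right] at e1
    nlinarith [sq_nonneg ‖τ • w‖]
  have h11 := mul_le_mul_of_nonneg_left h10 (inv_pos.2 hβ'pos).le
  have h12 := mul_le_mul_of_nonneg_left (h4.trans (by linarith [h3] :
    _ ≤ P.value z + inner ℝ y u + γ * s.d z - γ * s.q (z - xs) / 2)) hσ.le
  have h13 := mul_le_mul_of_nonneg_right hγ' (hs.d_nonneg hz.1)
  rw [h9] at h12
  rw [h6]
  linarith

/-- A step with two dual updates preserves the excessive gap. -/
theorem HasExcessiveGap.twoDual (h : P.IsAdmissible) (hs : s.IsCompatible P)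
    {τ γ β γ' β' : ℝ} (hτ : 0 < τ) (hτ1 : τ < 1) (hβ : 0 < β) (hγ'pos : 0 < γ')
    (hγ' : (1 - τ) * γ ≤ γ') (hβ' : β' = (1 - τ) * β) (hcond : s.L * τ ^ 2 ≤ γ' * β')
    {x x' : Euc n} {y y' : Euc m} (hg : HasExcessiveGap P s γ β x y)
    (hstep : IsStep P s τ γ β γ' β' x y x' y' .twoDual) :
    HasExcessiveGap P s γ' β' x' y' := by
  obtain ⟨xs, yh, hyh, hxs, rfl, rfl⟩ := hstep
  obtain ⟨hxsD, hgr⟩ := hxs.growth h hs hγ'pos.le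
  obtain ⟨hxD, hgap⟩ := hg
  have hL := hs.L_pos
  have hσ : 0 < 1 - τ := by linarith
  have hβ'pos : 0 < β' := hβ' ▸ mul_pos hσ hβ
  refine ⟨h.convexOn_effDomain.1 hxD hxsD hσ.le hτ.le (by ring), fun z hz => ?_⟩
  have h2 := h.convexOn_effDomain.2 hxD hxsD hσ.le hτ.le (by ring)
  simp only [smul_eq_mul] at h2
  have h3 := hgr z hz
  have h4 := hgap xs hxsD
  have h5 := hs.sq_norm_le (z - xs)
  rw [map_combo_sub]
  set v := P.A x - P.b with hv
  set w := P.A xs - P.b with hw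
  set u := P.A z - P.b with hu
  have hzs : P.A (z - xs) = u - w := by rw [hu, hw, map_sub]; abel
  rw [hzs, norm_sub_sq_real] at h5
  rw [inner_add_left, real_inner_smul_left w u]
  -- The second dual update adds `(γ' / L̄) w` to `yh`; its pairing with `u`, together with the
  -- growth term, controls `‖w‖²`.
  have h6 : γ' / s.L * (‖w‖ ^ 2 / 2) ≤
      γ' / s.L * inner ℝ w u + γ' * s.q (z - xs) / 2 := by
    calc _ ≤ γ' / s.L * (inner ℝ w u + s.L * s.q (z - xs) / 2) := by
          refine mul_le_mul_of_nonneg_left ?_ (div_pos hγ'pos hL).le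
          have := real_inner_comm u w
          nlinarith [sq_nonneg ‖u‖]
      _ = _ := by field_simp
  have h7 : inner ℝ yh w = (1 - τ) * inner ℝ y w + τ * (β⁻¹ * inner ℝ v w) := by
    rw [hyh, inner_add_left, real_inner_smul_left, real_inner_smul_left, real_inner_smul_left]
  -- Since `β' = (1 - τ) β`, the cross term equals the contribution of `β⁻¹ v` to `⟪yh, w⟫`. Only
  -- the `‖w‖²` term is left over, and `hcond` bounds it by the left side of `h6`.
  have h8 : ‖(1 - τ) • v + τ • w‖ ^ 2 / (2 * β') =
      (1 - τ) * (‖v‖ ^ 2 / (2 * β)) + τ * (β⁻¹ * inner ℝ v w) + τ ^ 2 / β' * (‖w‖ ^ 2 / 2) := by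
    rw [norm_add_sq_real, norm_smul, norm_smul, mul_pow, mul_pow, Real.norm_eq_abs,
      Real.norm_eq_abs, sq_abs, sq_abs, real_inner_smul_left, real_inner_smul_right, hβ']
    field_simp
  have h9 : τ ^ 2 / β' * (‖w‖ ^ 2 / 2) ≤ γ' / s.L * (‖w‖ ^ 2 / 2) := by
    refine mul_le_mul_of_nonneg_right ?_ (by positivity)
    rw [div_le_div_iff₀ hβ'pos hL]
    linarith
  have h10 := mul_le_mul_of_nonneg_left h4 hσ.le
  have h11 := mul_le_mul_of_nonneg_right hγ' (hs.d_nonneg hxsD.1)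
  rw [h7] at h3
  rw [h8]
  linarith

end ExcessiveGap

end PrimalDual

/-! ### The parameters and the smoothers -/

namespace PrimalDual

section Parameters

theorem aSeq_zero_zero : aSeq (fun _ => 0) 0 = (1 + √5) / 2 := by
  norm_num [aSeq]

theorem aSeq_zero_succ (k : ℕ) :
    aSeq (fun _ => 0) (k + 1) = (1 + √(4 * aSeq (fun _ => 0) k ^ 2 + 1)) / 2 := by
  norm_num [aSeq]

/-- For `c = 0` the term `a_{k+1}` is the positive root of `a² = a + a_k²`. It exceeds `a_k` by at
least `1 / 2`, which gives the linear growth. -/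
theorem aSeq_zero_spec (k : ℕ) :
    ((k : ℝ) + 3) / 2 ≤ aSeq (fun _ => 0) k ∧
      aSeq (fun _ => 0) (k + 1) ^ 2 = aSeq (fun _ => 0) (k + 1) + aSeq (fun _ => 0) k ^ 2 := by
  constructor
  · induction k with
    | zero =>
      have : (2 : ℝ) ≤ √5 := Real.le_sqrt_of_sq_le (by norm_num)
      rw [aSeq_zero_zero, Nat.cast_zero]
      linarith
    | succ k ih =>
      have hk : (0 : ℝ) ≤ k := k.cast_nonneg
      have : 2 * aSeq (fun _ => 0) k ≤ √(4 * aSeq (fun _ => 0) k ^ 2 + 1) :=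
        Real.le_sqrt_of_sq_le (by linarith)
      rw [aSeq_zero_succ, Nat.cast_succ]
      linarith
  · have h := Real.sq_sqrt (show 0 ≤ 4 * aSeq (fun _ => 0) k ^ 2 + 1 by positivity)
    rw [aSeq_zero_succ]
    linear_combination h / 4

theorem aSeq_zero_zero_sq : aSeq (fun _ => 0) 0 ^ 2 = aSeq (fun _ => 0) 0 + 1 := by
  have h := Real.sq_sqrt (show (0 : ℝ) ≤ 5 by norm_num)
  rw [aSeq_zero_zero]
  linear_combination h / 4

theorem one_lt_aSeq_zero (k : ℕ) : 1 < aSeq (fun _ => 0) k := by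
  have := (aSeq_zero_spec k).1
  have hk : (0 : ℝ) ≤ k := k.cast_nonneg
  linarith

theorem gammaSeq_zero (γ₀ : ℝ) (k : ℕ) : gammaSeq γ₀ (fun _ => 0) k = γ₀ := by
  induction k with
  | zero => rfl
  | succ k ih => simp [gammaSeq, ih]

/-- The recursion says `1 - τ_{k+1} = a_k² / a_{k+1}²`, so the product telescopes; the initial
factor is `1 - τ_0 = 1 / a_0²`, as `a_0` is the golden ratio. -/
theorem betaSeq_zero_succ (β₀ : ℝ) (k : ℕ) :
    betaSeq β₀ (fun _ => 0) (k + 1) = β₀ / aSeq (fun _ => 0) k ^ 2 := by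
  induction k with
  | zero =>
    have h1 := one_lt_aSeq_zero 0
    have h0 : aSeq (fun _ => 0) 0 ≠ 0 := by linarith
    simp only [betaSeq, tauSeq]
    rw [eq_div_iff (pow_ne_zero 2 h0)]
    have h2 := aSeq_zero_zero_sq
    field_simp
    linear_combination β₀ * h2
  | succ k ih =>
    have h1 := one_lt_aSeq_zero k
    have h2 := one_lt_aSeq_zero (k + 1)
    have h3 := (aSeq_zero_spec k).2
    rw [betaSeq, ih, tauSeq]
    have h0 : aSeq (fun _ => 0) k ≠ 0 := by linarith
    have h0' : aSeq (fun _ => 0) (k + 1) ≠ 0 := by linarith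
    field_simp
    linear_combination β₀ * h3

theorem betaSeq_zero_le {β₀ : ℝ} (hβ₀ : 0 ≤ β₀) (k : ℕ) :
    betaSeq β₀ (fun _ => 0) k ≤ β₀ * (4 / ((k : ℝ) + 2) ^ 2) := by
  cases k with
  | zero => simp [betaSeq]; norm_num
  | succ k =>
    have h1 := (aSeq_zero_spec k).1
    have hk : (0 : ℝ) ≤ k := k.cast_nonneg
    rw [betaSeq_zero_succ, div_eq_mul_inv]
    refine mul_le_mul_of_nonneg_left ?_ hβ₀
    have h2 : 0 < aSeq (fun _ => 0) k := one_pos.trans (one_lt_aSeq_zero k)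
    rw [← one_div, div_le_div_iff₀ (by positivity) (by positivity), Nat.cast_succ]
    nlinarith

theorem betaSeq_zero_pos {β₀ : ℝ} (hβ₀ : 0 < β₀) (k : ℕ) : 0 < betaSeq β₀ (fun _ => 0) k := by
  cases k with
  | zero => exact hβ₀
  | succ k =>
    rw [betaSeq_zero_succ]
    exact div_pos hβ₀ (pow_pos (one_pos.trans (one_lt_aSeq_zero k)) 2)

theorem tauSeq_zero_mem (k : ℕ) : 0 < tauSeq (fun _ => 0) k ∧ tauSeq (fun _ => 0) k < 1 :=
  ⟨inv_pos.2 (one_pos.trans (one_lt_aSeq_zero k)), inv_lt_one_of_one_lt₀ (one_lt_aSeq_zero k)⟩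

theorem tauSeq_one (k : ℕ) : tauSeq (fun _ => 1) k = ((k : ℝ) + 2)⁻¹ := by
  have : aSeq (fun _ => 1) k = k + 2 := by
    induction k with
    | zero =>
      have : √((1 + 1) ^ 2 : ℝ) = 2 := by rw [Real.sqrt_sq] <;> norm_num
      simp [aSeq, this]
      norm_num
    | succ k ih =>
      have h : √(4 * ((k : ℝ) + 2) ^ 2 + (1 - 1) ^ 2) = 2 * (k + 2) := by
        rw [show 4 * ((k : ℝ) + 2) ^ 2 + (1 - 1) ^ 2 = (2 * (k + 2)) ^ 2 by ring,
          Real.sqrt_sq (by positivity)]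
      simp only [aSeq, ih, h, Nat.cast_succ]
      ring
  rw [tauSeq, this]

theorem betaSeq_one (β₀ : ℝ) (k : ℕ) : betaSeq β₀ (fun _ => 1) k = β₀ / (k + 1) := by
  induction k with
  | zero => simp [betaSeq]
  | succ k ih =>
    rw [betaSeq, ih, tauSeq_one, Nat.cast_succ]
    field_simp
    ring

theorem gammaSeq_one (γ₀ : ℝ) (k : ℕ) : gammaSeq γ₀ (fun _ => 1) k = γ₀ / (k + 1) := by
  induction k with
  | zero => simp [gammaSeq]
  | succ k ih =>
    rw [gammaSeq, ih, tauSeq_one, Nat.cast_succ]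
    field_simp
    ring

end Parameters

/-! ### Compatibility of the augmented Lagrangian and Bregman smoothers -/

section Smoothers

variable {n m : ℕ} {P : Problem n m}

theorem norm_sq_combo {E : Type*} [NormedAddCommGroup E] [InnerProductSpace ℝ E] (u v : E) (t : ℝ) :
    ‖(1 - t) • u + t • v‖ ^ 2 = (1 - t) * ‖u‖ ^ 2 + t * ‖v‖ ^ 2 - t * (1 - t) * ‖v - u‖ ^ 2 := by
  rw [norm_add_sq_real, norm_sub_sq_real, norm_smul, norm_smul, mul_pow, mul_pow, Real.norm_eq_abs,
    Real.norm_eq_abs, sq_abs, sq_abs, real_inner_smul_left, real_inner_smul_right,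
    real_inner_comm u v]
  ring

theorem alSmoother_isCompatible (xc : Euc n) : (alSmoother P xc).IsCompatible P where
  L_pos := one_pos
  sq_norm_le z := by simp [alSmoother]
  q_smul t z := by simp [alSmoother, norm_smul, mul_pow]
  half_q_le x _ := by simp [alSmoother]; linarith
  d_combo_le x _ z _ t _ _ := by
    have h1 := norm_sq_combo (P.A x - P.A xc) (P.A z - P.A xc) t
    have h2 : P.A ((1 - t) • x + t • z) - P.A xc
        = (1 - t) • (P.A x - P.A xc) + t • (P.A z - P.A xc) := by
      rw [map_add, map_smul, map_smul]
      module
    simp only [alSmoother, h2, h1, map_sub, sub_sub_sub_cancel_right]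
    linarith

theorem StrongConvexOn.combo_le {X : Set (Euc n)} {σ : ℝ} {b : Euc n → ℝ}
    (hb : StrongConvexOn X σ b) {x z : Euc n} (hx : x ∈ X) (hz : z ∈ X) {t : ℝ} (h0 : 0 ≤ t)
    (h1 : t ≤ 1) :
    b ((1 - t) • x + t • z) ≤ (1 - t) * b x + t * b z - t * (1 - t) / 2 * (σ * ‖z - x‖ ^ 2) := by
  have := hb.2 hx hz (sub_nonneg.2 h1) h0 (by ring)
  rw [norm_sub_rev] at this
  simp only [smul_eq_mul] at this
  linarith

/-- Divide the strong convexity inequality on the segment from `z` to `x` by `t` and let `t`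
decrease to `0`; the difference quotient tends to the directional derivative at `z`. -/
theorem IsProxFunction.half_sq_le_bregman {X : Set (Euc n)} {σ : ℝ} {b : Euc n → ℝ}
    (hb : IsProxFunction X σ b) {x z : Euc n} (hx : x ∈ X) (hz : z ∈ X) :
    σ * ‖x - z‖ ^ 2 / 2 ≤ bregman b x z := by
  have hd : HasDerivAt (fun t : ℝ => b (z + t • (x - z))) (inner ℝ (gradient b z) (x - z)) 0 := by
    have hg := (hb.differentiableAt z hz).hasGradientAt.hasFDerivAt
    have hline : HasDerivAt (fun t : ℝ => z + t • (x - z)) (x - z) 0 := by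
      simpa using ((hasDerivAt_id (0 : ℝ)).smul_const (x - z)).const_add z
    have := HasFDerivAt.comp_hasDerivAt (0 : ℝ) (f := fun t : ℝ => z + t • (x - z))
      (by simpa using hg) hline
    simpa [Function.comp_def] using this
  have hslope := hd.tendsto_slope_zero_right
  have hlim : Filter.Tendsto (fun t : ℝ => b x - b z - (1 - t) / 2 * (σ * ‖x - z‖ ^ 2))
      (nhdsWithin 0 (Set.Ioi 0)) (nhds (b x - b z - (1 - 0) / 2 * (σ * ‖x - z‖ ^ 2))) := by
    refine (Continuous.tendsto ?_ 0).mono_left nhdsWithin_le_nhds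
    fun_prop
  have hle := le_of_tendsto_of_tendsto hslope hlim (by
    filter_upwards [Ioo_mem_nhdsGT (show (0 : ℝ) < 1 by norm_num)] with t ht
    have h1 := StrongConvexOn.combo_le hb.strongConvexOn hz hx ht.1.le ht.2.le
    have h2 : (1 - t) • z + t • x = z + t • (x - z) := by module
    rw [h2] at h1
    simp only [zero_add, zero_smul, add_zero, smul_eq_mul]
    rw [inv_mul_le_iff₀ ht.1]
    linarith)
  unfold bregman
  linarith

theorem bdSmoother_isCompatible {σ : ℝ} {b : Euc n → ℝ} {xc : Euc n} (hA : P.A ≠ 0)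
    (hb : IsProxFunction P.X σ b) (hxc : xc ∈ P.X) : (bdSmoother P σ b xc).IsCompatible P where
  L_pos := div_pos (pow_pos (norm_pos_iff.2 hA) 2) hb.pos
  sq_norm_le z := by
    have h1 : ‖P.A‖ ^ 2 / σ * (σ * ‖z‖ ^ 2) = (‖P.A‖ * ‖z‖) ^ 2 := by
      have := hb.pos.ne'
      field_simp
    simp only [bdSmoother, h1]
    exact pow_le_pow_left₀ (norm_nonneg _) (P.A.le_opNorm z) 2
  q_smul t z := by
    simp only [bdSmoother, norm_smul, mul_pow, Real.norm_eq_abs, sq_abs]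
    ring
  half_q_le x hx := hb.half_sq_le_bregman hx hxc
  d_combo_le x hx z hz t h0 h1 := by
    have h2 := StrongConvexOn.combo_le hb.strongConvexOn hx hz h0 h1
    have h3 : (1 - t) • x + t • z - xc = (1 - t) • (x - xc) + t • (z - xc) := by module
    simp only [bdSmoother, bregman, h3, inner_add_right, real_inner_smul_right]
    linarith

end Smoothers

end PrimalDual

/-! ### Convergence bounds -/

namespace PrimalDual

section Convergence

variable {n m : ℕ} {P : Problem n m} {s : Smoother n}

/-- With `c = 0` the parameter `γ` stays constant and `β_{k+1} = (L̄ / γ₀) τ_k²`, so the step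
condition `L̄ τ² ≤ γ' β'` holds with equality. -/
theorem IsRun.hasExcessiveGap_twoDual (h : P.IsAdmissible) (hs : s.IsCompatible P)
    {start : StartRule} {γ₀ : ℝ} (hγ₀ : 0 < γ₀) {N : ℕ} {x : ℕ → Euc n} {y : ℕ → Euc m}
    (hr : IsRun P s .twoDual start γ₀ (fun _ => 0) N x y) :
    ∀ k ≤ N, HasExcessiveGap P s γ₀ (betaSeq (s.L / γ₀) (fun _ => 0) k) (x k) (y k) := by
  have hβ₀ : 0 < s.L / γ₀ := div_pos hs.L_pos hγ₀
  intro k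
  induction k with
  | zero => exact fun _ => hasExcessiveGap_of_isStart h hs hγ₀ hr.1
  | succ k ih =>
    intro hk
    obtain ⟨hτ, hτ1⟩ := tauSeq_zero_mem k
    have hstep := hr.2 k hk
    rw [gammaSeq_zero, gammaSeq_zero] at hstep
    refine (ih (Nat.le_of_succ_le hk)).twoDual h hs hτ hτ1 (betaSeq_zero_pos hβ₀ k) hγ₀ ?_ rfl ?_
      hstep
    · nlinarith
    · change _ ≤ γ₀ * betaSeq (s.L / γ₀) (fun _ => 0) (k + 1)
      rw [betaSeq_zero_succ, tauSeq]
      have ha : aSeq (fun _ => 0) k ≠ 0 := (one_pos.trans (one_lt_aSeq_zero k)).ne'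
      refine le_of_eq ?_
      field_simp

/-- With `c = 1` one has `τ_k = 1 / (k + 2)`, and both sides of the step condition equal `L̄ / (k +
2)²`. -/
theorem IsRun.hasExcessiveGap_twoPrimal (h : P.IsAdmissible) (hs : s.IsCompatible P)
    {start : StartRule} {γ₀ : ℝ} (hγ₀ : 0 < γ₀) {N : ℕ} {x : ℕ → Euc n} {y : ℕ → Euc m}
    (hr : IsRun P s .twoPrimal start γ₀ (fun _ => 1) N x y) :
    ∀ k ≤ N, HasExcessiveGap P s (γ₀ / (k + 1)) (s.L / γ₀ / (k + 1)) (x k) (y k) := by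
  have hβ₀ : 0 < s.L / γ₀ := div_pos hs.L_pos hγ₀
  intro k
  induction k with
  | zero =>
    intro _
    simpa using hasExcessiveGap_of_isStart h hs hγ₀ hr.1
  | succ k ih =>
    intro hk
    have hstep := hr.2 k hk
    have hk0 : (0 : ℝ) ≤ k := k.cast_nonneg
    rw [gammaSeq_one, gammaSeq_one, betaSeq_one, betaSeq_one, tauSeq_one] at hstep
    refine (ih (Nat.le_of_succ_le hk)).twoPrimal h hs (by positivity)
      (inv_lt_one_of_one_lt₀ (by linarith)) (by positivity) (by positivity) ?_ ?_ ?_ hstep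
    · rw [Nat.cast_succ]
      refine le_of_eq ?_
      field_simp
      ring
    · rw [Nat.cast_succ]
      field_simp
      ring
    · rw [Nat.cast_succ]
      refine le_of_eq ?_
      field_simp
      ring

/-- For the augmented Lagrangian smoother, the primal iterates of the scheme with two primal updates
minimize quadratic penalty functions. -/
theorem IsRun.penalty_minimal (h : P.IsAdmissible) {xc : Euc n} (hxc : P.A xc = P.b)
    {start : StartRule} {N : ℕ} {x : ℕ → Euc n} {y : ℕ → Euc m}
    (hr : IsRun P (alSmoother P xc) .twoPrimal start 1 (fun _ => 0) N x y) :
    ∀ k ≤ N, x k ∈ P.effDomain ∧ ∀ z ∈ P.effDomain,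
      P.value (x k) + ‖P.A (x k) - P.b‖ ^ 2 / (2 * betaSeq 1 (fun _ => 0) k) ≤
        P.value z + ‖P.A z - P.b‖ ^ 2 / (2 * betaSeq 1 (fun _ => 0) k) := by
  have hprox : ∀ {β : ℝ}, 0 < β → ∀ {xh x : Euc n},
      IsProx P (alSmoother P xc) β xh (β⁻¹ • (P.A xh - P.b)) x → x ∈ P.effDomain ∧
      ∀ z ∈ P.effDomain, P.value x + ‖P.A x - P.b‖ ^ 2 / (2 * β) ≤
        P.value z + ‖P.A z - P.b‖ ^ 2 / (2 * β) := by
    intro β hβ xh x hx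
    obtain ⟨hxD, hmin⟩ := IsProx.minimal h hx
    -- Completing the square: `yh` is the multiplier `β⁻¹ (A xh - b)`, so the proximal objective is
    -- the penalty function up to a constant.
    have key : ∀ z, ‖P.A z - P.b‖ ^ 2 / (2 * β) = ‖P.A xh - P.b‖ ^ 2 / (2 * β)
        + inner ℝ (β⁻¹ • (P.A xh - P.b)) (P.A (z - xh)) + 1 / (2 * β) * ‖P.A (z - xh)‖ ^ 2 := by
      intro z
      have : P.A z - P.b = (P.A xh - P.b) + P.A (z - xh) := by rw [map_sub]; abel
      rw [this, norm_add_sq_real, real_inner_smul_left]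
      field_simp
    refine ⟨hxD, fun z hz => ?_⟩
    have := hmin z hz
    simp only [alSmoother] at this
    rw [key x, key z]
    linarith
  intro k hk
  cases k with
  | zero =>
    have h0 := hr.1
    simp only [betaSeq]
    cases start with
    | dualZero =>
      -- With `γ₀ = β₀ = 1` and `A x_c = b`, the smoothing term is itself the quadratic penalty.
      obtain ⟨hxD, hmin⟩ := h.isArgmin_real h0.1
      refine ⟨hxD, fun z hz => ?_⟩
      have := hmin z hz
      simp only [alSmoother, inner_zero_left, hxc] at this
      linarith
    | proxCenter =>
      obtain ⟨hy, hx⟩ := h0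
      rw [hy] at hx
      have hβ : (alSmoother P xc).L / 1 = 1 := by simp [alSmoother]
      rw [hβ] at hx
      exact hprox one_pos hx
  | succ k =>
    obtain ⟨xs, xh, yh, -, -, rfl, hx, -⟩ := hr.2 k hk
    have hβ : (alSmoother P xc).L / 1 = 1 := by simp [alSmoother]
    rw [hβ] at hx
    exact hprox (betaSeq_zero_pos one_pos _) hx

/-- The bounds that follow from an upper bound for the penalized objective. -/
theorem bounds_of_penalized_le (h : P.IsAdmissible) {x : Euc n} (hx : x ∈ P.effDomain) {β Δ : ℝ}
    (hβ : 0 < β) (hΔ : 0 ≤ Δ)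
    (hpen : ∀ z ∈ P.effDomain, P.A z = P.b →
      P.value x + ‖P.A x - P.b‖ ^ 2 / (2 * β) ≤ P.value z + Δ) :
    0 ≤ P.dualRadius ∧ ‖P.A x - P.b‖ ≤ 2 * β * P.dualRadius + √(2 * β * Δ) ∧
      ((-P.dualRadius * ‖P.A x - P.b‖ : ℝ) : EReal) ≤ P.f x - P.optVal ∧
      P.f x - P.optVal ≤ (Δ : EReal) := by
  obtain ⟨z, hz, hzA, hopt, hD, hlow⟩ := h.exists_optimal_lower_bound
  have h1 := hpen z hz hzA
  have h2 := hlow x hx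
  rw [hopt, ← h.coe_value hx.2, ← EReal.coe_sub]
  set r := ‖P.A x - P.b‖ with hr
  have hr0 : 0 ≤ r := norm_nonneg _
  have hquad : 0 ≤ r ^ 2 / (2 * β) := by positivity
  refine ⟨hD, ?_, EReal.coe_le_coe_iff.2 (by linarith), EReal.coe_le_coe_iff.2 (by linarith)⟩
  have h3 : r ^ 2 / (2 * β) ≤ P.dualRadius * r + Δ := by linarith
  rw [div_le_iff₀ (by positivity)] at h3
  have hS := Real.sq_sqrt (show 0 ≤ 2 * β * Δ by positivity)
  have hS0 := Real.sqrt_nonneg (2 * β * Δ)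
  have hE : 0 ≤ 2 * β * P.dualRadius := by positivity
  -- If `r > E + S` with `E = 2 β D` and `S = √(2 β Δ)`, then `r² > E r + S r ≥ E r + S²`, against
  -- `h3`.
  by_contra hn
  push Not at hn
  have h4 : r * (2 * β * P.dualRadius + √(2 * β * Δ)) < r * r :=
    mul_lt_mul_of_pos_left hn (by linarith)
  have h5 : √(2 * β * Δ) * √(2 * β * Δ) ≤ r * √(2 * β * Δ) :=
    mul_le_mul_of_nonneg_right (by linarith) hS0
  linarith

theorem isEpsSolution_of_bounds {x : Euc n} {ρ Δ ε : ℝ} (hx : x ∈ P.X) (hD : 0 ≤ P.dualRadius)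
    (hρ : ‖P.A x - P.b‖ ≤ ρ)
    (hlow : ((-P.dualRadius * ‖P.A x - P.b‖ : ℝ) : EReal) ≤ P.f x - P.optVal)
    (hup : P.f x - P.optVal ≤ (Δ : EReal)) (h1 : ρ ≤ ε) (h2 : P.dualRadius * ρ ≤ ε) (h3 : Δ ≤ ε) :
    P.IsEpsSolution ε x := by
  have := mul_le_mul_of_nonneg_left hρ hD
  exact ⟨hx, (EReal.coe_le_coe_iff.2 (by linarith)).trans hlow,
    hup.trans (EReal.coe_le_coe_iff.2 h3), hρ.trans h1⟩

/-- The smoothing term vanishes at feasible points, so there is no excess over the optimal value and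
the square root disappears. Only `L̄ = γ₀ = 1` enters `β`, which keeps `‖A‖` out of the rate. -/
theorem alSmoother_bounds (h : P.IsAdmissible) {xc : Euc n} (hxc : P.A xc = P.b)
    {scheme : Scheme} {start : StartRule} {x : ℕ → Euc n} {y : ℕ → Euc m} {k : ℕ}
    (hr : IsRun P (alSmoother P xc) scheme start 1 (fun _ => 0) k x y) :
    x k ∈ P.X ∧ 0 ≤ P.dualRadius ∧ ‖P.A (x k) - P.b‖ ≤ 8 * P.dualRadius / ((k : ℝ) + 1) ^ 2 ∧
      ((-P.dualRadius * ‖P.A (x k) - P.b‖ : ℝ) : EReal) ≤ P.f (x k) - P.optVal ∧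
      P.f (x k) - P.optVal ≤ 0 := by
  have hpen : x k ∈ P.effDomain ∧ ∀ z ∈ P.effDomain, P.A z = P.b →
      P.value (x k) + ‖P.A (x k) - P.b‖ ^ 2 / (2 * betaSeq 1 (fun _ => 0) k) ≤
        P.value z + 0 := by
    cases scheme with
    | twoPrimal =>
      obtain ⟨hxD, hmin⟩ := hr.penalty_minimal h hxc k le_rfl
      refine ⟨hxD, fun z hz hzA => ?_⟩
      simpa [hzA] using hmin z hz
    | twoDual =>
      obtain ⟨hxD, hgap⟩ :=
        hr.hasExcessiveGap_twoDual h (alSmoother_isCompatible xc) one_pos k le_rfl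
      refine ⟨hxD, fun z hz hzA => ?_⟩
      simpa [alSmoother, hzA, hxc] using hgap z hz
  obtain ⟨hD, h1, h2, h3⟩ :=
    bounds_of_penalized_le h hpen.1 (betaSeq_zero_pos one_pos k) le_rfl hpen.2
  refine ⟨hpen.1.1, hD, ?_, h2, by simpa using h3⟩
  rw [mul_zero, Real.sqrt_zero, add_zero] at h1
  have hk : (0 : ℝ) ≤ k := k.cast_nonneg
  have h4 : betaSeq 1 (fun _ => 0) k ≤ 4 / ((k : ℝ) + 1) ^ 2 := by
    refine (betaSeq_zero_le zero_le_one k).trans ?_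
    rw [one_mul]
    gcongr
    norm_num
  calc _ ≤ 2 * betaSeq 1 (fun _ => 0) k * P.dualRadius := h1
    _ ≤ 2 * (4 / ((k : ℝ) + 1) ^ 2) * P.dualRadius := by gcongr
    _ = _ := by ring

theorem bregman_le_proxDiameter {X : Set (Euc n)} {b : Euc n → ℝ}
    (hb : BddAbove (bregmanValues X b)) {x z : Euc n} (hx : x ∈ X) (hz : z ∈ X) :
    bregman b x z ≤ proxDiameter X b :=
  le_csSup hb ⟨x, hx, z, hz, rfl⟩

theorem proxDiameter_nonneg {X : Set (Euc n)} {b : Euc n → ℝ} (hb : BddAbove (bregmanValues X b))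
    {x : Euc n} (hx : x ∈ X) : 0 ≤ proxDiameter X b := by
  have := bregman_le_proxDiameter hb hx hx
  simpa [bregman] using this

variable {σ : ℝ} {b : Euc n → ℝ} {xc : Euc n} {start : StartRule} {x : ℕ → Euc n}
  {y : ℕ → Euc m} {k : ℕ} {L : ℝ}

theorem bdSmoother_bounds_of_gap (h : P.IsAdmissible) (hbdd : BddAbove (bregmanValues P.X b))
    (hxc : xc ∈ P.X) {γ β : ℝ} (hγ : 0 < γ) (hβ : 0 < β) {u : Euc n} {w : Euc m}
    (hg : HasExcessiveGap P (bdSmoother P σ b xc) γ β u w) :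
    0 ≤ P.dualRadius ∧
      ‖P.A u - P.b‖ ≤ 2 * β * P.dualRadius + √(2 * β * (γ * proxDiameter P.X b)) ∧
      ((-P.dualRadius * ‖P.A u - P.b‖ : ℝ) : EReal) ≤ P.f u - P.optVal ∧
      P.f u - P.optVal ≤ ((γ * proxDiameter P.X b : ℝ) : EReal) := by
  refine bounds_of_penalized_le h hg.1 hβ
    (mul_nonneg hγ.le (proxDiameter_nonneg hbdd hxc)) fun z hz hzA => ?_
  have h1 := hg.2 z hz
  have h2 := mul_le_mul_of_nonneg_left (bregman_le_proxDiameter hbdd hz.1 hxc) hγ.le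
  rw [hzA, sub_self, inner_zero_right, add_zero] at h1
  exact h1.trans (by simpa [bdSmoother] using h2)

/-- The choice `γ₀ = √L` makes `β₀ = √L` too, so `γ_k = β_k = √L / (k + 1)`: smoothing error and
feasibility gap decay at the same rate. -/
theorem bdSmoother_twoPrimal_bounds (h : P.IsAdmissible) (hA : P.A ≠ 0)
    (hb : IsProxFunction P.X σ b) (hbdd : BddAbove (bregmanValues P.X b)) (hxc : xc ∈ P.X)
    (hL : L = ‖P.A‖ ^ 2 / σ)
    (hr : IsRun P (bdSmoother P σ b xc) .twoPrimal start (√L) (fun _ => 1) k x y) :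
    x k ∈ P.X ∧ 0 ≤ P.dualRadius ∧
      ‖P.A (x k) - P.b‖
        ≤ √L * (2 * P.dualRadius + √(2 * proxDiameter P.X b)) / ((k : ℝ) + 1) ∧
      ((-P.dualRadius * ‖P.A (x k) - P.b‖ : ℝ) : EReal) ≤ P.f (x k) - P.optVal ∧
      P.f (x k) - P.optVal ≤ ((√L / ((k : ℝ) + 1) * proxDiameter P.X b : ℝ) : EReal) := by
  have hs := bdSmoother_isCompatible hA hb hxc
  have hL0 : 0 < L := hL ▸ hs.L_pos
  have hsL : (bdSmoother P σ b xc).L = L := hL.symm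
  have hg := hr.hasExcessiveGap_twoPrimal h hs (Real.sqrt_pos.2 hL0) k le_rfl
  rw [hsL, Real.div_sqrt] at hg
  have hpos : 0 < √L / ((k : ℝ) + 1) := div_pos (Real.sqrt_pos.2 hL0) (by positivity)
  obtain ⟨hD, h1, h2, h3⟩ := bdSmoother_bounds_of_gap h hbdd hxc hpos hpos hg
  refine ⟨hg.1.1, hD, h1.trans (le_of_eq ?_), h2, h3⟩
  have h4 : 2 * (√L / ((k : ℝ) + 1)) * (√L / ((k : ℝ) + 1) * proxDiameter P.X b)
      = (√L / ((k : ℝ) + 1)) ^ 2 * (2 * proxDiameter P.X b) := by ring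
  rw [h4, Real.sqrt_mul (sq_nonneg _), Real.sqrt_sq hpos.le]
  ring

theorem bdSmoother_twoDual_bounds (h : P.IsAdmissible) (hA : P.A ≠ 0)
    (hb : IsProxFunction P.X σ b) (hbdd : BddAbove (bregmanValues P.X b)) (hxc : xc ∈ P.X)
    (hL : L = ‖P.A‖ ^ 2 / σ)
    (hr : IsRun P (bdSmoother P σ b xc) .twoDual start (2 * √(2 * L) / ((k : ℝ) + 1)) (fun _ => 0)
      k x y) :
    x k ∈ P.X ∧ 0 ≤ P.dualRadius ∧
      ‖P.A (x k) - P.b‖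
        ≤ 2 * √(2 * L) * (P.dualRadius + √(proxDiameter P.X b)) / ((k : ℝ) + 1) ∧
      ((-P.dualRadius * ‖P.A (x k) - P.b‖ : ℝ) : EReal) ≤ P.f (x k) - P.optVal ∧
      P.f (x k) - P.optVal
        ≤ ((2 * √(2 * L) / ((k : ℝ) + 1) * proxDiameter P.X b : ℝ) : EReal) := by
  have hs := bdSmoother_isCompatible hA hb hxc
  have hL0 : 0 < L := hL ▸ hs.L_pos
  have hsL : (bdSmoother P σ b xc).L = L := hL.symm
  have hk : (0 : ℝ) ≤ k := k.cast_nonneg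
  have hX := proxDiameter_nonneg hbdd hxc
  have hγ : 0 < 2 * √(2 * L) / ((k : ℝ) + 1) :=
    div_pos (mul_pos two_pos (Real.sqrt_pos.2 (by positivity))) (by positivity)
  have hγsq : (2 * √(2 * L) / ((k : ℝ) + 1)) ^ 2 * ((k : ℝ) + 1) ^ 2 = 8 * L := by
    have := Real.sq_sqrt (show 0 ≤ 2 * L by positivity)
    rw [div_pow, div_mul_cancel₀ _ (by positivity)]
    linear_combination 4 * this
  have hg := hr.hasExcessiveGap_twoDual h hs hγ k le_rfl
  rw [hsL] at hg
  have hbound : 2 * √(2 * L) * (P.dualRadius + √(proxDiameter P.X b)) / ((k : ℝ) + 1)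
      = 2 * √(2 * L) / ((k : ℝ) + 1) * (P.dualRadius + √(proxDiameter P.X b)) := by ring
  rw [hbound]
  set γ := 2 * √(2 * L) / ((k : ℝ) + 1) with hγdef
  have hβ₀ : 0 < L / γ := div_pos hL0 hγ
  have hβpos := betaSeq_zero_pos hβ₀ k
  -- The horizon-dependent `γ` satisfies `γ² = 8 L / (k + 1)²`, which is what makes `2 β_k ≤ 8 L /
  -- (γ (k + 2)²)` at most `γ`.
  have hβ : 2 * betaSeq (L / γ) (fun _ => 0) k ≤ γ := by
    have h1 := betaSeq_zero_le hβ₀.le k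
    have h2 : 2 * (L / γ * (4 / ((k : ℝ) + 2) ^ 2)) ≤ γ := by
      have : 2 * (L / γ * (4 / ((k : ℝ) + 2) ^ 2)) = 8 * L / (γ * ((k : ℝ) + 2) ^ 2) := by
        field_simp
        ring
      rw [this, div_le_iff₀ (by positivity), ← hγsq]
      calc γ ^ 2 * ((k : ℝ) + 1) ^ 2 ≤ γ ^ 2 * ((k : ℝ) + 2) ^ 2 := by gcongr; norm_num
        _ = _ := by ring
    linarith
  obtain ⟨hD, h1, h2, h3⟩ := bdSmoother_bounds_of_gap h hbdd hxc hγ hβpos hg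
  refine ⟨hg.1.1, hD, h1.trans ?_, h2, h3⟩
  have h4 : √(2 * betaSeq (L / γ) (fun _ => 0) k * (γ * proxDiameter P.X b))
      ≤ γ * √(proxDiameter P.X b) := by
    calc _ ≤ √(γ ^ 2 * proxDiameter P.X b) := by
          refine Real.sqrt_le_sqrt ?_
          rw [pow_two, mul_assoc γ]
          exact mul_le_mul_of_nonneg_right hβ (mul_nonneg hγ.le hX)
      _ = _ := by rw [Real.sqrt_mul (sq_nonneg _), Real.sqrt_sq hγ.le]
  have h5 := mul_le_mul_of_nonneg_right hβ hD
  linarith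

/-- An iterate whose feasibility gap and suboptimality are at most `M / N` and `B / N` is an
`ε`-solution once `N` is at least a constant multiple of `ε⁻¹`. -/
theorem isEpsSolution_of_rate {u : Euc n} {M B N ε : ℝ} (hu : u ∈ P.X) (hD : 0 ≤ P.dualRadius)
    (hM : 0 ≤ M) (hB : 0 ≤ B) (hN : 0 < N) (hε : 0 < ε) (hρ : ‖P.A u - P.b‖ ≤ M / N)
    (hlow : ((-P.dualRadius * ‖P.A u - P.b‖ : ℝ) : EReal) ≤ P.f u - P.optVal)
    (hup : P.f u - P.optVal ≤ ((B / N : ℝ) : EReal))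
    (hC : (M + P.dualRadius * M + B) * ε⁻¹ ≤ N) : P.IsEpsSolution ε u := by
  rw [← div_eq_mul_inv, div_le_iff₀ hε] at hC
  have hDM := mul_nonneg hD hM
  refine isEpsSolution_of_bounds hu hD hρ hlow hup ?_ ?_ ?_
  · rw [div_le_iff₀ hN]
    linarith
  · rw [← mul_div_assoc, div_le_iff₀ hN]
    linarith
  · rw [div_le_iff₀ hN]
    linarith

end Convergence

end PrimalDual

open PrimalDual in
theorem theorem4p1 :
    -- the dual solution set is nonempty and has an element of minimum norm
    (∀ (n m : ℕ) (P : Problem n m), P.IsAdmissible →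
      IsLeast ((fun y => ‖y‖) '' P.dualSolutions) P.dualRadius) ∧
    -- (a) the bounds for the augmented Lagrangian smoother
    (∀ (n m : ℕ) (P : Problem n m) (xc : Euc n) (scheme : Scheme) (start : StartRule)
        (x : ℕ → Euc n) (y : ℕ → Euc m) (k : ℕ),
      P.IsAdmissible → xc ∈ P.X → P.A xc = P.b →
      IsRun P (alSmoother P xc) scheme start 1 (fun _ => 0) k x y →
      ‖P.A (x k) - P.b‖ ≤ 8 * P.dualRadius / ((k : ℝ) + 1) ^ 2 ∧
      ((-(1 / 2) * ‖P.A (x k) - P.b‖ ^ 2 - P.dualRadius * ‖P.A (x k) - P.b‖ : ℝ) : EReal)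
        ≤ P.f (x k) - P.optVal ∧
      P.f (x k) - P.optVal ≤ 0) ∧
    -- (a) the complexity, with a constant that depends only on the minimum dual norm
    (∃ C : ℝ → ℝ, ∀ (n m : ℕ) (P : Problem n m) (xc : Euc n) (scheme : Scheme) (start : StartRule)
        (x : ℕ → Euc n) (y : ℕ → Euc m) (k : ℕ) (ε : ℝ),
      P.IsAdmissible → xc ∈ P.X → P.A xc = P.b →
      IsRun P (alSmoother P xc) scheme start 1 (fun _ => 0) k x y →
      0 < ε → C P.dualRadius * ε ^ (-(1 / 2) : ℝ) ≤ (k : ℝ) + 1 →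
      P.IsEpsSolution ε (x k)) ∧
    -- (b) the bounds for the Bregman smoother and two primal steps
    (∀ (n m : ℕ) (P : Problem n m) (σ : ℝ) (b : Euc n → ℝ) (xc : Euc n) (start : StartRule)
        (x : ℕ → Euc n) (y : ℕ → Euc m) (k : ℕ) (L : ℝ),
      P.IsAdmissible → P.A ≠ 0 → IsProxFunction P.X σ b → BddAbove (bregmanValues P.X b) →
      xc ∈ P.X → L = ‖P.A‖ ^ 2 / σ →
      IsRun P (bdSmoother P σ b xc) .twoPrimal start (√L) (fun _ => 1) k x y →
      ‖P.A (x k) - P.b‖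
        ≤ √L * (2 * P.dualRadius + √(2 * proxDiameter P.X b)) / ((k : ℝ) + 1) ∧
      ((-P.dualRadius * ‖P.A (x k) - P.b‖ : ℝ) : EReal) ≤ P.f (x k) - P.optVal ∧
      P.f (x k) - P.optVal ≤ ((√L / ((k : ℝ) + 1) * proxDiameter P.X b : ℝ) : EReal)) ∧
    -- (b) the complexity
    (∃ C : ℝ → ℝ → ℝ → ℝ, ∀ (n m : ℕ) (P : Problem n m) (σ : ℝ) (b : Euc n → ℝ) (xc : Euc n)
        (start : StartRule) (x : ℕ → Euc n) (y : ℕ → Euc m) (k : ℕ) (L ε : ℝ),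
      P.IsAdmissible → P.A ≠ 0 → IsProxFunction P.X σ b → BddAbove (bregmanValues P.X b) →
      xc ∈ P.X → L = ‖P.A‖ ^ 2 / σ →
      IsRun P (bdSmoother P σ b xc) .twoPrimal start (√L) (fun _ => 1) k x y →
      0 < ε → C L P.dualRadius (proxDiameter P.X b) * ε⁻¹ ≤ (k : ℝ) + 1 →
      P.IsEpsSolution ε (x k)) ∧
    -- (c) the bounds for the Bregman smoother, two dual steps and a fixed horizon `K`
    (∀ (n m : ℕ) (P : Problem n m) (σ : ℝ) (b : Euc n → ℝ) (xc : Euc n) (start : StartRule)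
        (x : ℕ → Euc n) (y : ℕ → Euc m) (K : ℕ) (L : ℝ),
      P.IsAdmissible → P.A ≠ 0 → IsProxFunction P.X σ b → BddAbove (bregmanValues P.X b) →
      xc ∈ P.X → L = ‖P.A‖ ^ 2 / σ →
      IsRun P (bdSmoother P σ b xc) .twoDual start (2 * √(2 * L) / ((K : ℝ) + 1)) (fun _ => 0) K x y →
      ‖P.A (x K) - P.b‖
        ≤ 2 * √(2 * L) * (P.dualRadius + √(proxDiameter P.X b)) / ((K : ℝ) + 1) ∧
      ((-P.dualRadius * ‖P.A (x K) - P.b‖ : ℝ) : EReal) ≤ P.f (x K) - P.optVal ∧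
      P.f (x K) - P.optVal
        ≤ ((2 * √(2 * L) / ((K : ℝ) + 1) * proxDiameter P.X b : ℝ) : EReal)) ∧
    -- (c) the complexity
    (∃ C : ℝ → ℝ → ℝ → ℝ, ∀ (n m : ℕ) (P : Problem n m) (σ : ℝ) (b : Euc n → ℝ) (xc : Euc n)
        (start : StartRule) (x : ℕ → Euc n) (y : ℕ → Euc m) (K : ℕ) (L ε : ℝ),
      P.IsAdmissible → P.A ≠ 0 → IsProxFunction P.X σ b → BddAbove (bregmanValues P.X b) →
      xc ∈ P.X → L = ‖P.A‖ ^ 2 / σ →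
      IsRun P (bdSmoother P σ b xc) .twoDual start (2 * √(2 * L) / ((K : ℝ) + 1)) (fun _ => 0) K x y →
      0 < ε → C L P.dualRadius (proxDiameter P.X b) * ε⁻¹ ≤ (K : ℝ) + 1 →
      P.IsEpsSolution ε (x K)) := by
  refine ⟨fun n m P h => h.isLeast_dualRadius, ?_, ?_, ?_, ?_, ?_, ?_⟩
  · intro n m P xc scheme start x y k h _ hxc hr
    obtain ⟨-, -, h1, h2, h3⟩ := alSmoother_bounds h hxc hr
    refine ⟨h1, le_trans (EReal.coe_le_coe_iff.2 ?_) h2, h3⟩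
    -- Strong duality already gives the lower bound without the quadratic term; subtracting that
    -- term only weakens it.
    linarith [sq_nonneg ‖P.A (x k) - P.b‖]
  -- Squaring the condition on `k` gives `(8 D + 1)² ≤ ε (k + 1)²`, and `(8 D + 1)²` dominates both
  -- `8 D` (feasibility) and `8 D²` (lower bound on the objective).
  · refine ⟨fun D => 8 * D + 1, fun n m P xc scheme start x y k ε h _ hxc hr hε hk => ?_⟩
    obtain ⟨hX, hD, h1, h2, h3⟩ := alSmoother_bounds h hxc hr
    have hN : (0 : ℝ) < (k : ℝ) + 1 := by positivity
    have hε2 : (ε ^ (-(1 / 2) : ℝ)) ^ 2 = ε⁻¹ := by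
      rw [← Real.rpow_natCast, ← Real.rpow_mul hε.le]
      norm_num [Real.rpow_neg_one]
    have hsq := pow_le_pow_left₀ (by positivity) hk 2
    rw [mul_pow, hε2, ← div_eq_mul_inv, div_le_iff₀ hε] at hsq
    refine isEpsSolution_of_bounds (Δ := 0) hX hD h1 h2 (by simpa using h3) ?_ ?_ hε.le
    · rw [div_le_iff₀ (by positivity)]
      nlinarith
    · rw [← mul_div_assoc, div_le_iff₀ (by positivity)]
      nlinarith
  · intro n m P σ b xc start x y k L h hA hb hbdd hxc hL hr
    exact (bdSmoother_twoPrimal_bounds h hA hb hbdd hxc hL hr).2.2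
  -- The constant is `M + D M + B`, with `M` the numerator of the feasibility rate and `B` that of
  -- the upper objective bound.
  · refine ⟨fun L D X => √L * (2 * D + √(2 * X)) + D * (√L * (2 * D + √(2 * X))) + √L * X,
      fun n m P σ b xc start x y k L ε h hA hb hbdd hxc hL hr hε hk => ?_⟩
    obtain ⟨hX, hD, h1, h2, h3⟩ := bdSmoother_twoPrimal_bounds h hA hb hbdd hxc hL hr
    have hdiam := proxDiameter_nonneg hbdd hxc
    rw [div_mul_eq_mul_div] at h3
    exact isEpsSolution_of_rate hX hD (by positivity) (by positivity) (by positivity) hε h1 h2 h3 hk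
  · intro n m P σ b xc start x y K L h hA hb hbdd hxc hL hr
    exact (bdSmoother_twoDual_bounds h hA hb hbdd hxc hL hr).2.2
  · refine ⟨fun L D X => 2 * √(2 * L) * (D + √X) + D * (2 * √(2 * L) * (D + √X))
      + 2 * √(2 * L) * X,
      fun n m P σ b xc start x y K L ε h hA hb hbdd hxc hL hr hε hK => ?_⟩
    obtain ⟨hX, hD, h1, h2, h3⟩ := bdSmoother_twoDual_bounds h hA hb hbdd hxc hL hr
    have hdiam := proxDiameter_nonneg hbdd hxc
    rw [div_mul_eq_mul_div] at h3
    exact isEpsSolution_of_rate hX hD (by positivity) (by positivity) (by positivity) hε h1 h2 h3 hK
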